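/- An ideal on $\mathbb{N}$ is a non-empty family $I\subseteq\mathcal{P}(\mathbb{N})$ closed under subsets and finite unions; $\mathrm{Fin}$ is the ideal of finite sets. $I$ is a $P$-ideal if for every sequence $(A_k)$ in $I$ there is $B\in I$ such that $A_k\setminus B$ is finite for all $k$; $I$ is $\boldsymbol\Sigma^0_2$ if it is a countable union of closed subsets of $\mathcal{P}(\mathbb{N})=\{0,1\}^{\mathbb{N}}$; $I$ is a trivial modification of $\mathrm{Fin}$ if $I=\{B\subseteq\mathbb{N}: A\cap B\in\mathrm{Fin}\}$ for some $A\subseteq\mathbb{N}$. A lower semi-continuous submeasure on $\mathbb{N}$ is a map $\phi:\mathcal{P}(\mathbb{N})\to[0,\infty]$ that is monotone and subadditive, with $\phi(\emptyset)=0$, $\phi(\{n\})<\infty$ for all $n$, and $\phi(\bigcup_m A_m)=\lim_m\phi(A_m)$ whenever $A_0\subseteq A_1\subseteq\dots$. Say that $\phi$ represents $I$ if $\phi(\{n\})>0$ for all $n$ and $I=\mathrm{Exh}(\phi)=\{A:\lim_m\phi(A\setminus[0,m])=0\}$. Let $S_I$ be the group of all permutations $g$ of $\mathbb{N}$ with support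 $\{n: g(n)\neq n\}\in I$. A topological group is Polish if it is separable and completely metrizable. A Polish group $G$ has ample generics if for every $n\in\mathbb{N}$ the diagonal action of $G$ on $G^{n+1}$ by conjugation has a comeager orbit. It is non-archimedean if it is isomorphic, as a topological group, to a subgroup of the group $S_\infty$ of all permutations of $\mathbb{N}$ with the topology of pointwise convergence (equivalently, if its open subgroups form a neighbourhood base at the identity). A space is zero-dimensional if its clopen sets form a basis. **Corollary.** Let $I$ be a $\boldsymbol\Sigma^0_2$ $P$-ideal on $\mathbb{N}$ that contains $\mathrm{Fin}$ and is not a trivial modification of $\mathrm{Fin}$. Then some lower semi-continuous submeasure represents $I$; the metrics $d(f,g)=\phi(\{n: f(n)\neq g(n)\})$, for $\phi$ representing $I$, all induce the same topology $\tau_I$ on $S_I$; and $(S_I,\tau_I)$ is a Polish group with ample generics that is not zero-dimensional, and is not non-archimedean. The summable ideal $I_S=\{A\subseteq\mathbb{N}:\sum_{n\in A}1/n<\infty\}$ (where $n=0$ is ignored in the sum) is an ideal of this kind, so $S_{I_S}$ is such a group. In particular, there exists a Polish group with ample generics that is not non-archimedean. -/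

import Mathlib

open scoped ENNReal Topology
open Filter

/-! ### Ideals on `ℕ` (order ideals of the Boolean algebra of all subsets of `ℕ`) -/

/-- `I` contains the ideal `Fin` of all finite sets. -/
def ContainsFin (I : Order.Ideal (Set ℕ)) : Prop :=
  ∀ A : Set ℕ, A.Finite → A ∈ I

/-- `I` is a `P`-ideal: every sequence of members of `I` has a pseudo-union in `I`. -/
def IsPIdeal (I : Order.Ideal (Set ℕ)) : Prop :=
  ∀ A : ℕ → Set ℕ, (∀ k, A k ∈ I) → ∃ B ∈ I, ∀ k, (A k \ B).Finite

/-- `I` is `Σ⁰₂`, i.e. a countable union of closed subsets of the Cantor space of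
characteristic functions of subsets of `ℕ`. -/
def IsSigmaZeroTwo (I : Order.Ideal (Set ℕ)) : Prop :=
  ∃ F : ℕ → Set (ℕ → Bool), (∀ k, IsClosed (F k)) ∧
    {x : ℕ → Bool | {n | x n = true} ∈ I} = ⋃ k, F k

/-- `I` is a trivial modification of `Fin`: for some `A ⊆ ℕ`, it consists of exactly those `B`
for which `A ∩ B` is finite. -/
def IsTrivialModificationOfFin (I : Order.Ideal (Set ℕ)) : Prop :=
  ∃ A : Set ℕ, ∀ B : Set ℕ, B ∈ I ↔ (A ∩ B).Finite

/-- The summable ideal `{A ⊆ ℕ : ∑_{n ∈ A} 1 / n < ∞}`. (The index `n = 0` contributes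
`1 / 0 = 0`, so it does not influence membership.) -/
def summableIdeal : Order.Ideal (Set ℕ) where
  carrier := {A | Summable fun n : A => 1 / ((n : ℕ) : ℝ)}
  lower' := by
    intro A B hBA hA
    exact Summable.comp_injective (i := Set.inclusion hBA) hA (Set.inclusion_injective hBA)
  nonempty' := ⟨∅, by
    change Summable fun n : (∅ : Set ℕ) => 1 / ((n : ℕ) : ℝ)
    exact Summable.of_finite⟩
  directed' := by
    intro A hA B hB
    refine ⟨A ∪ B, ?_, Set.subset_union_left, Set.subset_union_right⟩
    have hA' := (summable_subtype_iff_indicator (f := fun n : ℕ => 1 / (n : ℝ))).1 hA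
    have hB' := (summable_subtype_iff_indicator (f := fun n : ℕ => 1 / (n : ℝ))).1 hB
    refine (summable_subtype_iff_indicator (f := fun n : ℕ => 1 / (n : ℝ))).2
      (Summable.of_nonneg_of_le (fun n => ?_) (fun n => ?_) (hA'.add hB'))
    · exact Set.indicator_nonneg (fun _ _ => by positivity) n
    · have h0 : 0 ≤ 1 / (n : ℝ) := by positivity
      by_cases h1 : n ∈ A <;> by_cases h2 : n ∈ B <;>
        simp only [Set.indicator, Set.mem_union, h1, h2, or_self, or_true, true_or, or_false,
          if_true, if_false] <;> linarith

/-! ### Lower semi-continuous submeasures -/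

/-- A lower semi-continuous submeasure on `ℕ`. -/
structure LSCSubmeasure where
  toFun : Set ℕ → ℝ≥0∞
  empty' : toFun ∅ = 0
  mono' : ∀ A B : Set ℕ, A ⊆ B → toFun A ≤ toFun B
  union_le' : ∀ A B : Set ℕ, toFun (A ∪ B) ≤ toFun A + toFun B
  singleton_lt_top' : ∀ n : ℕ, toFun {n} < ∞
  tendsto_iUnion' : ∀ A : ℕ → Set ℕ, Monotone A →
    Tendsto (fun m => toFun (A m)) atTop (𝓝 (toFun (⋃ m, A m)))

/-- `φ` represents `I`: all points have positive submeasure and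
`I = Exh(φ) = {A : lim_m φ(A \ [0,m]) = 0}`. -/
def LSCSubmeasure.Represents (φ : LSCSubmeasure) (I : Order.Ideal (Set ℕ)) : Prop :=
  (∀ n : ℕ, 0 < φ.toFun {n}) ∧
    ∀ A : Set ℕ, A ∈ I ↔ Tendsto (fun m : ℕ => φ.toFun (A \ Set.Icc 0 m)) atTop (𝓝 0)

/-! ### The group `S_I` and its topology -/

/-- The group `S_I` of all permutations of `ℕ` whose support belongs to `I`. -/
def permGroup (I : Order.Ideal (Set ℕ)) : Subgroup (Equiv.Perm ℕ) where
  carrier := {g | {n | g n ≠ n} ∈ I}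
  one_mem' := by
    change {n : ℕ | (1 : Equiv.Perm ℕ) n ≠ n} ∈ I
    simpa using I.bot_mem
  mul_mem' := by
    intro f g hf hg
    refine I.lower (fun n hn => ?_) (Order.Ideal.sup_mem hf hg)
    by_contra h
    have h' : f n = n ∧ g n = n := by
      simpa [not_or] using h
    exact hn (by simp [h'.1, h'.2])
  inv_mem' := by
    intro g hg
    refine I.lower (fun n hn => ?_) hg
    intro h
    exact hn (by rw [Equiv.Perm.inv_eq_iff_eq]; exact h.symm)

/-- The metric `d(f, g) = φ({f ≠ g})` on `S_I`. (It takes finite values and separates points when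
`φ` represents `I`.) -/
@[reducible] noncomputable def LSCSubmeasure.permMetric (φ : LSCSubmeasure) (I : Order.Ideal (Set ℕ)) :
    PseudoEMetricSpace (permGroup I) where
  edist f g := φ.toFun {n | f.1 n ≠ g.1 n}
  edist_self f := by simpa using φ.empty'
  edist_comm f g := by simp only [ne_comm]
  edist_triangle f g h := by
    refine (φ.mono' _ ({n | f.1 n ≠ g.1 n} ∪ {n | g.1 n ≠ h.1 n}) (fun n hn => ?_)).trans
      (φ.union_le' _ _)
    by_contra hc
    have hc' : f.1 n = g.1 n ∧ g.1 n = h.1 n := by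
      simpa [not_or] using hc
    exact hn (hc'.1.trans hc'.2)

/-- `τ` is the topology `τ_I` of `S_I`: the ideal `I` is represented by some lower
semi-continuous submeasure, and for every such `φ` the topology `τ` is given by the metric
`d(f, g) = φ({f ≠ g})`. There is at most one such `τ`. -/
def IsIdealTopology (I : Order.Ideal (Set ℕ)) (τ : TopologicalSpace (permGroup I)) : Prop :=
  (∃ φ : LSCSubmeasure, φ.Represents I) ∧
    ∀ φ : LSCSubmeasure, φ.Represents I →
      τ = (φ.permMetric I).toUniformSpace.toTopologicalSpace

/-! ### Topological groups -/

/-- `G` has ample generics: for every `n`, the diagonal conjugation action of `G` on `G ^ (n + 1)`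
has a comeager orbit. -/
def HasAmpleGenerics (G : Type*) [Group G] [TopologicalSpace G] : Prop :=
  ∀ n : ℕ, ∃ x : Fin (n + 1) → G,
    {y : Fin (n + 1) → G | ∃ g : G, y = fun i => g * x i * g⁻¹} ∈ residual (Fin (n + 1) → G)

/-- `X` is zero-dimensional: the clopen sets form a basis of the topology. -/
def IsZeroDimensional (X : Type*) [TopologicalSpace X] : Prop :=
  TopologicalSpace.IsTopologicalBasis {U : Set X | IsClopen U}

/-- `G` is non-archimedean: it is isomorphic, as a topological group, to a subgroup of the group
`S_∞` of all permutations of `ℕ`, with the topology of pointwise convergence (`ℕ` discrete). -/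
def IsNonArchimedean (G : Type*) [Group G] [TopologicalSpace G] : Prop :=
  ∃ j : G →* Equiv.Perm ℕ, Topology.IsEmbedding (fun (g : G) (n : ℕ) => j g n)

/-- `G` is a Polish group with ample generics that is not zero-dimensional and not
non-archimedean, neither as a subgroup of `S_∞` nor in the sense of open subgroups forming a
neighbourhood base at the identity. -/
structure IsNonNonArchimedeanPolishAmple (G : Type*) [Group G] [TopologicalSpace G] : Prop where
  isTopologicalGroup : IsTopologicalGroup G
  polishSpace : PolishSpace G
  hasAmpleGenerics : HasAmpleGenerics G
  not_isZeroDimensional : ¬ IsZeroDimensional G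
  not_isNonArchimedean : ¬ IsNonArchimedean G
  not_nonarchimedeanGroup : ¬ NonarchimedeanGroup G

/-! ### Submeasures representing the same ideal induce the same topology -/

namespace LSCSubmeasure

/-! The representing submeasure comes from Baire category. One closed piece of the `Σ⁰₂` ideal `I`
is already cofinal modulo finite sets, by the `P`-property, and its hereditary closure gives a
closed family inside `I` containing a tail of every member. A category argument on the square of a
reduced closed piece shrinks such families so that unions of three members stay in the previous
family (`exists_tailFamily_seq`). A Frink-style chain argument turns the sequence into a submeasure
`φ`. Besides representing `I`, it satisfies `φ A < 1 → A ∈ I`, which is what later keeps limits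
inside the ideal.

The metric of `φ` dominates pointwise convergence. Imposing it on both `g` and `g⁻¹` gives a
complete metric for the same topology, hence a Polish group.

Since `I` is not a trivial modification of `Fin`, some set outside `I` has points of vanishing
submeasure. Swapping pairs of such points, one reaches from the identity elements of large
displacement by arbitrarily small jumps. A clopen set contained in a small ball would have to be
left on the way, and a limit of the exits lies both in it and in its complement
(`Represents.exists_le_of_isClopen`). This refutes zero-dimensionality and both forms of being
non-archimedean.

For ample generics, a tuple is an action of a free group. Comeagerly, all orbits are finite and
every finite index subgroup is a stabilizer infinitely often. Two such actions are isomorphic, since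
they have equally many orbits of each type. The isomorphism can be taken inside a member of `I` that
contains both supports and an infinite set of common fixed points, so the conjugator lies in `S_I`.
-/

theorem iUnion_le (φ : LSCSubmeasure) (A : ℕ → Set ℕ) :
    φ.toFun (⋃ k, A k) ≤ ∑' k, φ.toFun (A k) := by
  have hB : Monotone fun m : ℕ => ⋃ k ∈ Finset.range m, A k := by
    intro a b hab x
    simp only [Set.mem_iUnion, Finset.mem_range, exists_prop]
    exact fun ⟨k, hk, h⟩ => ⟨k, by omega, h⟩
  have hU : (⋃ m : ℕ, ⋃ k ∈ Finset.range m, A k) = ⋃ k, A k := by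
    ext x
    simp only [Set.mem_iUnion, Finset.mem_range, exists_prop]
    exact ⟨fun ⟨_, k, _, h⟩ => ⟨k, h⟩, fun ⟨k, h⟩ => ⟨k + 1, k, by omega, h⟩⟩
  have hle : ∀ m : ℕ, φ.toFun (⋃ k ∈ Finset.range m, A k) ≤ ∑ k ∈ Finset.range m, φ.toFun (A k) := by
    intro m
    induction m with
    | zero => simp [φ.empty']
    | succ m ih =>
      rw [Finset.sum_range_succ, Finset.range_add_one, Finset.set_biUnion_insert, Set.union_comm]
      exact (φ.union_le' _ _).trans (by gcongr)
  have := φ.tendsto_iUnion' _ hB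
  rw [hU] at this
  exact le_of_tendsto' this fun m => (hle m).trans (ENNReal.sum_le_tsum _)

/-- A set of submeasure above `c` has a finite subset of submeasure above `c`. -/
theorem exists_finite_subset_lt (φ : LSCSubmeasure) {A : Set ℕ} {c : ℝ≥0∞} (h : c < φ.toFun A) :
    ∃ m : ℕ, c < φ.toFun (A ∩ Set.Iic m) := by
  have hB : Monotone fun m : ℕ => A ∩ Set.Iic m := fun a b hab =>
    Set.inter_subset_inter_right _ (Set.Iic_subset_Iic.2 hab)
  have hU : (⋃ m : ℕ, A ∩ Set.Iic m) = A := by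
    rw [← Set.inter_iUnion, Set.iUnion_Iic, Set.inter_univ]
  have := φ.tendsto_iUnion' _ hB
  rw [hU] at this
  exact (this.eventually (lt_mem_nhds h)).exists

namespace Represents

variable {φ ψ : LSCSubmeasure} {I : Order.Ideal (Set ℕ)}

theorem exists_tail_lt (h : φ.Represents I) {A : Set ℕ} (hA : A ∈ I) {ε : ℝ≥0∞} (hε : 0 < ε) :
    ∃ m : ℕ, φ.toFun (A \ Set.Icc 0 m) < ε :=
  (((h.2 A).1 hA).eventually (gt_mem_nhds hε)).exists

theorem mem_of_forall_tail_le (h : φ.Represents I) {A : Set ℕ}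
    (hA : ∀ ε : ℝ≥0∞, 0 < ε → ∃ m : ℕ, φ.toFun (A \ Set.Icc 0 m) ≤ ε) : A ∈ I := by
  rw [h.2, ENNReal.tendsto_atTop_zero]
  intro ε hε
  obtain ⟨m, hm⟩ := hA ε hε
  refine ⟨m, fun n hn => (φ.mono' _ _ ?_).trans hm⟩
  exact Set.sdiff_subset_sdiff_right (Set.Icc_subset_Icc_right hn)

theorem mem_of_finite (h : φ.Represents I) {A : Set ℕ} (hA : A.Finite) : A ∈ I := by
  refine h.mem_of_forall_tail_le fun ε hε => ?_
  obtain ⟨m, hm⟩ := hA.bddAbove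
  refine ⟨m, ?_⟩
  have : A \ Set.Icc 0 m = ∅ := Set.sdiff_eq_empty.2 fun x hx => ⟨Nat.zero_le _, hm hx⟩
  rw [this, φ.empty']
  exact hε.le

/-- A tail of the series controls all but finitely many of the sets, and a long enough initial
interval removes the remaining ones. This is how members of `I` are built. -/
theorem iUnion_mem (h : φ.Represents I) (s : ℕ → Set ℕ) (hs : ∀ k, (s k).Finite)
    (hsum : ∑' k, φ.toFun (s k) ≠ ∞) : (⋃ k, s k) ∈ I := by
  refine h.mem_of_forall_tail_le fun ε hε => ?_
  have := ENNReal.tendsto_sum_nat_add _ hsum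
  obtain ⟨K, hK⟩ := (this.eventually (gt_mem_nhds hε)).exists
  obtain ⟨m, hm⟩ := ((Finset.range K).finite_toSet.biUnion fun k _ => hs k).bddAbove
  refine ⟨m, le_trans (φ.mono' _ (⋃ k, s (k + K)) ?_) ((φ.iUnion_le _).trans hK.le)⟩
  rintro x ⟨hx, hxm⟩
  obtain ⟨k, hk⟩ := Set.mem_iUnion.1 hx
  rcases lt_or_ge k K with hkK | hkK
  · exact absurd ⟨by omega, hm (Set.mem_biUnion (by simpa using hkK) hk)⟩ hxm
  · exact Set.mem_iUnion.2 ⟨k - K, by rwa [Nat.sub_add_cancel hkK]⟩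

/-- If the submeasures of a sequence of sets tend to `0`, then the sets leave every finite set. -/
theorem eventually_disjoint (h : φ.Represents I) {s : ℕ → Set ℕ}
    (hs : Tendsto (fun k => φ.toFun (s k)) atTop (𝓝 0)) (m : ℕ) :
    ∀ᶠ k in atTop, Disjoint (s k) (Set.Icc 0 m) := by
  have : ∀ n ∈ Finset.Icc 0 m, ∀ᶠ k in atTop, n ∉ s k := by
    intro n _
    filter_upwards [hs.eventually (gt_mem_nhds (h.1 n))] with k hk hn
    exact absurd hk (not_lt.2 (φ.mono' _ _ (by simpa using hn)))
  filter_upwards [(Finset.eventually_all _).2 this] with k hk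
  rw [Set.disjoint_left]
  exact fun n hn hnm => hk n (by simpa using hnm) hn

/-- Two submeasures that represent the same ideal have the same small sets. -/
theorem exists_lt_of_lt (hφ : φ.Represents I) (hψ : ψ.Represents I) {ε : ℝ≥0∞} (hε : 0 < ε) :
    ∃ δ : ℝ≥0∞, 0 < δ ∧ ∀ A, φ.toFun A < δ → ψ.toFun A < ε := by
  by_contra! hcon
  -- Lower semi-continuity yields finite subsets only above a strictly smaller value, hence `η`.
  obtain ⟨η, hη0, hηε⟩ := exists_between hε
  have hpos : ∀ k : ℕ, (0 : ℝ≥0∞) < 2⁻¹ ^ k := fun k =>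
    ENNReal.pow_pos (by simp) k
  choose A hA1 hA2 using fun k : ℕ => hcon (2⁻¹ ^ k) (hpos k)
  choose m hm using fun k => ψ.exists_finite_subset_lt (hηε.trans_le (hA2 k))
  set s : ℕ → Set ℕ := fun k => A k ∩ Set.Iic (m k)
  have hsφ : ∀ k, φ.toFun (s k) ≤ 2⁻¹ ^ k := fun k =>
    (φ.mono' _ _ Set.inter_subset_left).trans (hA1 k).le
  have hsum : ∑' k, φ.toFun (s k) ≠ ∞ := by
    refine ne_top_of_le_ne_top ?_ (ENNReal.tsum_le_tsum hsφ)
    rw [ENNReal.tsum_geometric]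
    simp
  have hmem := hφ.iUnion_mem s (fun k => (Set.finite_Iic _).inter_of_right _) hsum
  obtain ⟨n, hn⟩ := hψ.exists_tail_lt hmem hη0
  -- The union is in `I` because of `φ`, yet each of its tails contains some `s k`, whose `ψ`-value
  -- exceeds `η`.
  obtain ⟨k, hk⟩ := (hφ.eventually_disjoint (ENNReal.tendsto_atTop_zero_of_tsum_ne_top hsum) n).exists
  refine absurd ((hm k).trans_le (ψ.mono' _ _ ?_)) (not_lt.2 hn.le)
  exact fun x hx => ⟨Set.mem_iUnion.2 ⟨k, hx⟩, Set.disjoint_left.1 hk hx⟩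

theorem topology_le (hφ : φ.Represents I) (hψ : ψ.Represents I) :
    (φ.permMetric I).toUniformSpace.toTopologicalSpace ≤
      (ψ.permMetric I).toUniformSpace.toTopologicalSpace := by
  refine le_of_nhds_le_nhds fun f => ?_
  refine ((@Metric.nhds_basis_eball _ (φ.permMetric I) f).le_basis_iff
    (@Metric.nhds_basis_eball _ (ψ.permMetric I) f)).2 fun ε hε => ?_
  obtain ⟨δ, hδ, h⟩ := hφ.exists_lt_of_lt hψ hε
  exact ⟨δ, hδ, fun g hg => h _ hg⟩

theorem topology_eq (hφ : φ.Represents I) (hψ : ψ.Represents I) :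
    (φ.permMetric I).toUniformSpace.toTopologicalSpace =
      (ψ.permMetric I).toUniformSpace.toTopologicalSpace :=
  le_antisymm (hφ.topology_le hψ) (hψ.topology_le hφ)

theorem isIdealTopology (hφ : φ.Represents I) :
    IsIdealTopology I (φ.permMetric I).toUniformSpace.toTopologicalSpace :=
  ⟨⟨φ, hφ⟩, fun _ hψ => hφ.topology_eq hψ⟩

end Represents

end LSCSubmeasure

/-! ### Tail families of a `Σ⁰₂` `P`-ideal by Baire category -/

/-- The subset of `ℕ` with characteristic function `x`. -/
def boolSupport (x : ℕ → Bool) : Set ℕ := {n | x n = true}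

theorem exists_boolSupport_eq (A : Set ℕ) : ∃ x, boolSupport x = A := by
  classical
  exact ⟨fun n => decide (n ∈ A), by ext n; simp [boolSupport]⟩

theorem isClopen_setOf_apply_eq_true (n : ℕ) : IsClopen {x : ℕ → Bool | x n = true} :=
  (isClopen_discrete {true}).preimage (continuous_apply n)

/-- `X` is cofinal in `I` for inclusion up to a finite set. -/
def IsAlmostCofinal (I : Order.Ideal (Set ℕ)) (X : Set (ℕ → Bool)) : Prop :=
  ∀ A ∈ I, ∃ x ∈ X, (A \ boolSupport x).Finite

theorem IsAlmostCofinal.mono {I : Order.Ideal (Set ℕ)} {X Y : Set (ℕ → Bool)}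
    (h : IsAlmostCofinal I X) (hXY : X ⊆ Y) : IsAlmostCofinal I Y := fun A hA =>
  let ⟨x, hx, hf⟩ := h A hA
  ⟨x, hXY hx, hf⟩

/-- If each piece missed some `A i`, a pseudo-union of all the `A i` would be missed by the whole
union. Thus non-cofinal sets form a `σ`-ideal. -/
theorem IsPIdeal.exists_isAlmostCofinal {I : Order.Ideal (Set ℕ)} (hI : IsPIdeal I)
    {ι : Type*} [Countable ι] (X : ι → Set (ℕ → Bool)) (h : IsAlmostCofinal I (⋃ i, X i)) :
    ∃ i, IsAlmostCofinal I (X i) := by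
  by_contra! hcon
  rcases isEmpty_or_nonempty ι with hι | hι
  · obtain ⟨x, hx, _⟩ := h ⊥ I.bot_mem
    simp at hx
  simp only [IsAlmostCofinal, not_forall, not_exists, not_and] at hcon
  choose A hA hAX using hcon
  obtain ⟨e, he⟩ := exists_surjective_nat ι
  obtain ⟨B, hB, hAB⟩ := hI (fun k => A (e k)) fun k => hA _
  obtain ⟨x, hx, hBx⟩ := h B hB
  obtain ⟨i, hi⟩ := Set.mem_iUnion.1 hx
  obtain ⟨k, rfl⟩ := he i
  refine hAX _ x hi (((hAB k).union hBx).subset fun n hn => ?_)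
  by_cases hnB : n ∈ B
  · exact Or.inr ⟨hnB, hn.2⟩
  · exact Or.inl ⟨hn.1, hnB⟩

/-- A closed cofinal set contains a closed set all of whose nonempty relatively open parts are
cofinal. -/
theorem IsPIdeal.exists_isClosed_forall_isAlmostCofinal {I : Order.Ideal (Set ℕ)}
    (hI : IsPIdeal I) {C : Set (ℕ → Bool)} (hC : IsClosed C) (hcof : IsAlmostCofinal I C) :
    ∃ Y ⊆ C, IsClosed Y ∧ Y.Nonempty ∧
      ∀ V, IsOpen V → (Y ∩ V).Nonempty → IsAlmostCofinal I (Y ∩ V) := by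
  set b := TopologicalSpace.countableBasis (ℕ → Bool)
  have hb := TopologicalSpace.isBasis_countableBasis (ℕ → Bool)
  -- As in the Cantor–Bendixson theorem, all basic open sets in which `C` is not cofinal are
  -- removed. They are countably many, so the removed part never carries cofinality.
  set N : Set (Set (ℕ → Bool)) := {V ∈ b | ¬ IsAlmostCofinal I (C ∩ V)}
  have hN : Countable N :=
    ((TopologicalSpace.countable_countableBasis (ℕ → Bool)).mono (Set.sep_subset _ _)).to_subtype
  have key : ∀ V, IsAlmostCofinal I (C ∩ V) → IsAlmostCofinal I ((C \ ⋃₀ N) ∩ V) := by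
    intro V hV
    obtain ⟨i, hi⟩ := hI.exists_isAlmostCofinal
      (fun i : Option N => i.elim ((C \ ⋃₀ N) ∩ V) fun W => C ∩ W.1) (hV.mono fun x hx => by
        by_cases hxN : x ∈ ⋃₀ N
        · obtain ⟨W, hW, hxW⟩ := hxN
          exact Set.mem_iUnion.2 ⟨some ⟨W, hW⟩, hx.1, hxW⟩
        · exact Set.mem_iUnion.2 ⟨none, ⟨hx.1, hxN⟩, hx.2⟩)
    rcases i with _ | W
    · exact hi
    · exact absurd hi W.2.2
  refine ⟨C \ ⋃₀ N, Set.sdiff_subset, ?_, ?_, ?_⟩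
  · exact hC.sdiff (isOpen_sUnion fun W hW => hb.isOpen hW.1)
  · obtain ⟨x, hx, _⟩ := key Set.univ (by rwa [Set.inter_univ]) ⊥ I.bot_mem
    exact ⟨x, hx.1⟩
  · rintro V hV ⟨x, hx, hxV⟩
    obtain ⟨W, hW, hxW, hWV⟩ := hb.exists_subset_of_mem_open hxV hV
    have hcW : IsAlmostCofinal I (C ∩ W) := by
      by_contra hn
      exact hx.2 ⟨W, ⟨hW, hn⟩, hxW⟩
    exact (key W hcW).mono (Set.inter_subset_inter_right _ hWV)

/-- `K` is hereditary and closed, and contains a tail of every member of `I`. -/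
structure IsTailFamily (I : Order.Ideal (Set ℕ)) (K : Set (Set ℕ)) : Prop where
  lower : ∀ A ∈ K, ∀ B ⊆ A, B ∈ K
  closed : ∀ A : Set ℕ, (∀ s : Finset ℕ, ↑s ⊆ A → (s : Set ℕ) ∈ K) → A ∈ K
  tail : ∀ A ∈ I, ∃ m : ℕ, A \ Set.Iio m ∈ K

/-- The closed hereditary family generated by the sets `boolSupport x \ [0, m)` with `x ∈ X`. -/
def finitaryHull (X : Set (ℕ → Bool)) (m : ℕ) : Set (Set ℕ) :=
  {A | ∀ s : Finset ℕ, ↑s ⊆ A → ∃ x ∈ X, ↑s ⊆ boolSupport x \ Set.Iio m}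

theorem IsAlmostCofinal.isTailFamily {I : Order.Ideal (Set ℕ)} {X : Set (ℕ → Bool)}
    (h : IsAlmostCofinal I X) (m : ℕ) : IsTailFamily I (finitaryHull X m) where
  lower A hA B hBA s hs := hA s (hs.trans hBA)
  closed A hA s hs := hA s hs s subset_rfl
  tail A hA := by
    obtain ⟨x, hx, hf⟩ := h A hA
    obtain ⟨N, hN⟩ := hf.bddAbove
    refine ⟨max m (N + 1), fun s hs => ⟨x, hx, fun n hn => ?_⟩⟩
    obtain ⟨hnA, hnN⟩ := hs hn
    simp only [Set.mem_Iio, not_lt, sup_le_iff] at hnN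
    refine ⟨?_, by simpa using hnN.1⟩
    by_contra hc
    have := hN ⟨hnA, hc⟩
    omega

theorem IsTailFamily.inter {I : Order.Ideal (Set ℕ)} {K L : Set (Set ℕ)} (hK : IsTailFamily I K)
    (hL : IsTailFamily I L) : IsTailFamily I (K ∩ L) where
  lower A hA B hBA := ⟨hK.lower A hA.1 B hBA, hL.lower A hA.2 B hBA⟩
  closed A hA := ⟨hK.closed A fun s hs => (hA s hs).1, hL.closed A fun s hs => (hA s hs).2⟩
  tail A hA := by
    obtain ⟨m, hm⟩ := hK.tail A hA
    obtain ⟨n, hn⟩ := hL.tail A hA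
    refine ⟨max m n, hK.lower _ hm _ ?_, hL.lower _ hn _ ?_⟩ <;>
      exact Set.sdiff_subset_sdiff_right (Set.Iio_subset_Iio (by simp))

theorem isTailFamily_disjoint_Iio (I : Order.Ideal (Set ℕ)) (n : ℕ) :
    IsTailFamily I {A | Disjoint A (Set.Iio n)} where
  lower A hA B hBA := Disjoint.mono_left hBA hA
  closed A hA := Set.disjoint_left.2 fun x hx =>
    Set.disjoint_left.1 (hA {x} (by simpa using hx)) (by simp)
  tail A _ := ⟨n, Set.disjoint_sdiff_left⟩

theorem IsTailFamily.empty_mem {I : Order.Ideal (Set ℕ)} {K : Set (Set ℕ)}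
    (hK : IsTailFamily I K) : ∅ ∈ K :=
  let ⟨_, hm⟩ := hK.tail _ I.bot_mem
  hK.lower _ hm _ (Set.empty_subset _)

/-- By compactness, elements of `C` that cover longer and longer initial parts of `A` yield one
element of `C` that covers `A`. -/
theorem finitaryHull_zero_subset {I : Order.Ideal (Set ℕ)} {C : Set (ℕ → Bool)} (hC : IsClosed C)
    (hCI : ∀ x ∈ C, boolSupport x ∈ I) : finitaryHull C 0 ⊆ I := by
  intro A hA
  have hcl : ∀ m : ℕ, IsClosed (C ∩ ⋂ n ∈ A ∩ Set.Iio m, {x : ℕ → Bool | x n = true}) := fun m =>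
    hC.inter (isClosed_biInter fun n _ => (isClopen_setOf_apply_eq_true n).1)
  obtain ⟨x, hx⟩ := IsCompact.nonempty_iInter_of_sequence_nonempty_isCompact_isClosed
    (fun m : ℕ => C ∩ ⋂ n ∈ A ∩ Set.Iio m, {x : ℕ → Bool | x n = true})
    (fun m => Set.inter_subset_inter_right _ (Set.biInter_subset_biInter_left
      (Set.inter_subset_inter_right _ (Set.Iio_subset_Iio (Nat.le_succ m)))))
    (fun m => by
      have hfin : (A ∩ Set.Iio m).Finite := (Set.finite_Iio m).inter_of_right _
      obtain ⟨x, hx, hs⟩ := hA hfin.toFinset (by simp)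
      exact ⟨x, hx, Set.mem_iInter₂.2 fun n hn => (hs (hfin.mem_toFinset.2 hn)).1⟩)
    (hcl 0).isCompact hcl
  refine I.lower (fun n hn => ?_) (hCI x (Set.mem_iInter.1 hx 0).1)
  exact Set.mem_iInter₂.1 (Set.mem_iInter.1 hx (n + 1)).2 n ⟨hn, by simp⟩

/-- Every tail family contains the pairwise unions of the members of a smaller tail family. -/
theorem IsTailFamily.exists_half {I : Order.Ideal (Set ℕ)} (hI : IsPIdeal I)
    {C : Set (ℕ → Bool)} (hC : IsClosed C) (hcof : IsAlmostCofinal I C)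
    (hCI : ∀ x ∈ C, boolSupport x ∈ I) {K : Set (Set ℕ)} (hK : IsTailFamily I K) :
    ∃ L, IsTailFamily I L ∧ ∀ A ∈ L, ∀ B ∈ L, A ∪ B ∈ K := by
  obtain ⟨Y, hYC, hYcl, ⟨y₀, hy₀⟩, hY⟩ := hI.exists_isClosed_forall_isAlmostCofinal hC hcof
  have : Nonempty Y := ⟨⟨y₀, hy₀⟩⟩
  have : CompactSpace Y := isCompact_iff_compactSpace.1 hYcl.isCompact
  set E : ℕ → Set (Y × Y) := fun m =>
    {p | (boolSupport p.1.1 ∪ boolSupport p.2.1) \ Set.Iio m ∈ K}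
  have hE : ∀ m, IsClosed (E m) := by
    intro m
    have : E m = ⋂ s : {s : Finset ℕ // (s : Set ℕ) ∉ K},
        {p | ¬ ((s.1 : Set ℕ) ⊆ (boolSupport p.1.1 ∪ boolSupport p.2.1) \ Set.Iio m)} := by
      ext p
      simp only [Set.mem_iInter, Set.mem_ofPred_eq, Subtype.forall]
      refine ⟨fun h s hs hsub => hs (hK.lower _ h _ hsub), fun h => hK.closed _ fun s hs => ?_⟩
      by_contra hc
      exact h s hc hs
    rw [this]
    refine isClosed_iInter fun s => ?_
    have : {p : Y × Y | ¬ ((s.1 : Set ℕ) ⊆ (boolSupport p.1.1 ∪ boolSupport p.2.1) \ Set.Iio m)} =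
        ⋃ n ∈ s.1, {p : Y × Y | ¬ ((p.1.1 n = true ∨ p.2.1 n = true) ∧ n ∉ Set.Iio m)} := by
      ext p
      simp [Set.subset_def, boolSupport]
    rw [this]
    refine Set.Finite.isClosed_biUnion s.1.finite_toSet fun n _ => ?_
    have h1 : IsClopen {p : Y × Y | p.1.1 n = true} :=
      (isClopen_setOf_apply_eq_true n).preimage (continuous_subtype_val.comp continuous_fst)
    have h2 : IsClopen {p : Y × Y | p.2.1 n = true} :=
      (isClopen_setOf_apply_eq_true n).preimage (continuous_subtype_val.comp continuous_snd)
    by_cases hn : n ∈ Set.Iio m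
    · simp [hn]
    · simpa [hn, Set.compl_def] using (h1.union h2).compl.1
  -- The union of two members of `I` has a tail in `K`. By Baire, one `m` works for a whole open
  -- rectangle.
  have hcov : ⋃ m, E m = Set.univ := by
    refine Set.eq_univ_of_forall fun p => Set.mem_iUnion.2 (hK.tail _ ?_)
    exact Order.Ideal.sup_mem (hCI _ (hYC p.1.2)) (hCI _ (hYC p.2.2))
  obtain ⟨m, ⟨y, y'⟩, hyy⟩ := nonempty_interior_of_iUnion_of_closed hE hcov
  obtain ⟨U, V, hU, hV, hyU, hyV, hUV⟩ := isOpen_prod_iff.1 isOpen_interior y y' hyy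
  obtain ⟨U', hU', rfl⟩ := isOpen_induced_iff.1 hU
  obtain ⟨V', hV', rfl⟩ := isOpen_induced_iff.1 hV
  -- Both sides of the rectangle remain cofinal by the choice of `Y`. With the intersection, a
  -- single family can serve in either coordinate.
  refine ⟨finitaryHull (Y ∩ U') m ∩ finitaryHull (Y ∩ V') m,
    ((hY U' hU' ⟨y, y.2, hyU⟩).isTailFamily m).inter ((hY V' hV' ⟨y', y'.2, hyV⟩).isTailFamily m),
    fun A hA B hB => hK.closed _ fun s hs => ?_⟩
  classical
  obtain ⟨x, hx, hxs⟩ := hA.1 (s.filter (· ∈ A)) (by intro n; simp)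
  obtain ⟨x', hx', hxs'⟩ := hB.2 (s.filter (· ∈ B)) (by intro n; simp)
  have hmem : ((⟨x, hx.1⟩, ⟨x', hx'.1⟩) : Y × Y) ∈ E m :=
    interior_subset (hUV ⟨hx.2, hx'.2⟩)
  refine hK.lower _ hmem _ fun n hn => ?_
  rcases hs hn with h | h
  · have := hxs (by simpa using ⟨hn, h⟩ : n ∈ (s.filter (· ∈ A) : Finset ℕ))
    exact ⟨Or.inl this.1, this.2⟩
  · have := hxs' (by simpa using ⟨hn, h⟩ : n ∈ (s.filter (· ∈ B) : Finset ℕ))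
    exact ⟨Or.inr this.1, this.2⟩

/-- The filtration of a `Σ⁰₂` `P`-ideal by tail families. -/
theorem exists_tailFamily_seq {I : Order.Ideal (Set ℕ)} (hσ : IsSigmaZeroTwo I) (hI : IsPIdeal I) :
    ∃ K : ℕ → Set (Set ℕ), K 0 ⊆ I ∧ (∀ n, IsTailFamily I (K n)) ∧
      (∀ n, ∀ A ∈ K n, Disjoint A (Set.Iio n)) ∧
      ∀ n, ∀ A ∈ K (n + 1), ∀ B ∈ K (n + 1), ∀ D ∈ K (n + 1), A ∪ B ∪ D ∈ K n := by
  obtain ⟨F, hFcl, hF⟩ := hσ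
  obtain ⟨i, hi⟩ := hI.exists_isAlmostCofinal F fun A hA => by
    obtain ⟨x, rfl⟩ := exists_boolSupport_eq A
    refine ⟨x, ?_, by simp⟩
    rw [← hF]
    exact hA
  have hCI : ∀ x ∈ F i, boolSupport x ∈ I := fun x hx => by
    have : x ∈ {x : ℕ → Bool | {n | x n = true} ∈ I} := hF ▸ Set.mem_iUnion.2 ⟨i, hx⟩
    exact this
  have step : ∀ n : ℕ, ∀ K : {K // IsTailFamily I K}, ∃ L : {L // IsTailFamily I L},
      (∀ A ∈ L.1, Disjoint A (Set.Iio (n + 1))) ∧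
      ∀ A ∈ L.1, ∀ B ∈ L.1, ∀ D ∈ L.1, A ∪ B ∪ D ∈ K.1 := by
    rintro n ⟨K, hK⟩
    -- Halving twice handles unions of three sets, as the chain argument needs. Avoiding `[0, n +
    -- 1)` will make the points have positive submeasure.
    obtain ⟨L, hL, hLK⟩ := hK.exists_half hI (hFcl i) hi hCI
    obtain ⟨M, hM, hML⟩ := hL.exists_half hI (hFcl i) hi hCI
    refine ⟨⟨M ∩ {A | Disjoint A (Set.Iio (n + 1))}, hM.inter (isTailFamily_disjoint_Iio I _)⟩,
      fun A hA => hA.2, fun A hA B hB D hD => hLK _ (hML A hA.1 B hB.1) _ ?_⟩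
    simpa using hML D hD.1 D hD.1
  choose f hf1 hf2 using step
  let K : ℕ → {K // IsTailFamily I K} := fun n =>
    Nat.rec ⟨finitaryHull (F i) 0, hi.isTailFamily 0⟩ (fun n K => f n K) n
  refine ⟨fun n => (K n).1, finitaryHull_zero_subset (hFcl i) hCI, fun n => (K n).2, ?_,
    fun n => hf2 n (K n)⟩
  rintro (_ | n)
  · intro A _
    exact Set.disjoint_left.2 fun x _ hx => absurd hx (Nat.not_lt_zero x)
  · exact hf1 n (K n)

/-! ### From tail families to a lower semi-continuous submeasure -/

theorem ENNReal.exists_sum_Ico_le_half (f : ℕ → ℝ≥0∞) {a b : ℕ} (hab : a < b)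
    (hf : ∑ i ∈ Finset.Ico a b, f i ≠ ∞) :
    ∃ c, a ≤ c ∧ c < b ∧ ∑ i ∈ Finset.Ico a c, f i ≤ (∑ i ∈ Finset.Ico a b, f i) / 2 ∧
      ∑ i ∈ Finset.Ico (c + 1) b, f i ≤ (∑ i ∈ Finset.Ico a b, f i) / 2 := by
  classical
  set S := ∑ i ∈ Finset.Ico a b, f i with hS
  -- The cut is the first term that brings the partial sum to half of the total.
  have hex : ∃ c, a ≤ c ∧ S / 2 ≤ ∑ i ∈ Finset.Ico a (c + 1), f i :=
    ⟨b - 1, by omega, by rw [Nat.sub_add_cancel (by omega)]; exact ENNReal.half_le_self⟩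
  obtain ⟨hac, hc⟩ := Nat.find_spec hex
  have hmin := fun k => Nat.find_min (H := hex) (m := k)
  set c := Nat.find hex
  have hcb : c < b := by
    refine lt_of_le_of_lt (Nat.find_min' hex (m := b - 1) ⟨by omega, ?_⟩) (by omega)
    rw [Nat.sub_add_cancel (by omega)]; exact ENNReal.half_le_self
  refine ⟨c, hac, hcb, ?_, ?_⟩
  · rcases hac.eq_or_lt with h | h
    · simp [← h]
    · have := hmin (c - 1) (by omega)
      rw [Nat.sub_add_cancel (by omega)] at this
      by_contra hcon
      exact this ⟨by omega, (not_le.1 hcon).le⟩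
  · by_contra hcon
    have hsum := Finset.sum_Ico_consecutive f (show a ≤ c + 1 by omega) (show c + 1 ≤ b by omega)
    have h2 : S / 2 ≠ ∞ := ne_top_of_le_ne_top hf ENNReal.half_le_self
    have := ENNReal.add_lt_add_of_le_of_lt h2 hc (not_le.1 hcon)
    rw [ENNReal.add_halves, hsum] at this
    exact lt_irrefl _ this

/-- The weight `inf {2⁻ⁿ : A ∈ K n}`, truncated at `1`. -/
noncomputable def familyWeight (K : ℕ → Set (Set ℕ)) (A : Set ℕ) : ℝ≥0∞ :=
  (⨅ (n : ℕ) (_ : A ∈ K n), 2⁻¹ ^ n) ⊓ 1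

theorem familyWeight_le {K : ℕ → Set (Set ℕ)} {A : Set ℕ} {n : ℕ} (h : A ∈ K n) :
    familyWeight K A ≤ 2⁻¹ ^ n :=
  inf_le_left.trans (iInf₂_le n h)

theorem familyWeight_empty {K : ℕ → Set (Set ℕ)} (h : ∀ n, ∅ ∈ K n) : familyWeight K ∅ = 0 := by
  refine le_antisymm (le_of_forall_gt fun ε hε => ?_) zero_le
  obtain ⟨n, hn⟩ := ENNReal.exists_inv_two_pow_lt hε.ne'
  exact (familyWeight_le (h n)).trans_lt hn

/-- The gain of one index comes from the weight being built from powers of `2⁻¹`: below `2⁻¹ ^ m`,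
the next possible value is `2⁻¹ ^ (m + 1)`. -/
theorem mem_of_familyWeight_lt {K : ℕ → Set (Set ℕ)} (hK : Antitone K) {A : Set ℕ} {m : ℕ}
    (h : familyWeight K A < 2⁻¹ ^ m) : A ∈ K (m + 1) := by
  rcases inf_lt_iff.1 h with h | h
  · obtain ⟨n, hn, hlt⟩ := by simpa only [iInf_lt_iff] using h
    refine hK ?_ hn
    by_contra hc
    exact absurd hlt (not_lt.2 (pow_le_pow_right_of_le_one' (by simp) (by omega)))
  · exact absurd h (not_lt.2 (pow_le_one' (by simp) m))

/-- Frink's chain argument: cut at a term that leaves at most half of the weight on each side. Both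
sides lie in `K (m + 1)` by induction, the middle term does so by its own weight, and three members
of `K (m + 1)` unite within `K m`. -/
theorem biUnion_Ico_mem_of_sum_familyWeight_lt {K : ℕ → Set (Set ℕ)} (hK : Antitone K)
    (h0 : ∀ n, ∅ ∈ K n)
    (h3 : ∀ n, ∀ A ∈ K (n + 1), ∀ B ∈ K (n + 1), ∀ D ∈ K (n + 1), A ∪ B ∪ D ∈ K n)
    (t : ℕ → Set ℕ) (l a b m : ℕ) (hl : b - a = l)
    (h : ∑ i ∈ Finset.Ico a b, familyWeight K (t i) < 2⁻¹ ^ m) :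
    (⋃ i ∈ Finset.Ico a b, t i) ∈ K m := by
  induction l using Nat.strong_induction_on generalizing a b m with
  | _ l ih =>
    rcases Nat.lt_or_ge a b with hab | hab
    · obtain ⟨c, hac, hcb, h1, h2⟩ :=
        ENNReal.exists_sum_Ico_le_half (fun i => familyWeight K (t i)) hab (ne_top_of_lt h)
      have hhalf : (∑ i ∈ Finset.Ico a b, familyWeight K (t i)) / 2 < 2⁻¹ ^ (m + 1) := by
        rw [pow_succ, div_eq_mul_inv]
        exact ENNReal.mul_lt_mul_left (by simp) (by simp) h
      have hA := ih (c - a) (by omega) a c (m + 1) rfl (h1.trans_lt hhalf)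
      have hD := ih (b - (c + 1)) (by omega) (c + 1) b (m + 1) rfl (h2.trans_lt hhalf)
      have hB : t c ∈ K (m + 1) := mem_of_familyWeight_lt hK
        ((Finset.single_le_sum (f := fun i => familyWeight K (t i)) (fun _ _ => zero_le)
          (Finset.mem_Ico.2 ⟨hac, hcb⟩)).trans_lt h)
      convert h3 m _ hA _ hB _ hD using 1
      ext x
      simp only [Set.mem_iUnion, Set.mem_union, Finset.mem_Ico, exists_prop]
      constructor
      · rintro ⟨i, hi, hx⟩
        rcases lt_trichotomy i c with h | h | h
        · exact Or.inl (Or.inl ⟨i, ⟨hi.1, h⟩, hx⟩)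
        · exact Or.inl (Or.inr (h ▸ hx))
        · exact Or.inr ⟨i, ⟨h, hi.2⟩, hx⟩
      · rintro ((⟨i, hi, hx⟩ | hx) | ⟨i, hi, hx⟩)
        · exact ⟨i, ⟨hi.1, by omega⟩, hx⟩
        · exact ⟨c, ⟨hac, hcb⟩, hx⟩
        · exact ⟨i, ⟨by omega, hi.2⟩, hx⟩
    · rw [Finset.Ico_eq_empty (by omega)]
      simpa using h0 m

/-- The lower semi-continuous submeasure generated by the values of a monotone subadditive
function on finite sets. -/
noncomputable def LSCSubmeasure.ofOuterMeasure (μ : MeasureTheory.OuterMeasure ℕ)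
    (hμ : ∀ n : ℕ, μ {n} < ∞) : LSCSubmeasure where
  toFun A := ⨆ (s : Finset ℕ) (_ : ↑s ⊆ A), μ s
  empty' := by
    simp only [Set.subset_empty_iff, Finset.coe_eq_empty]
    simp
  mono' A B h := iSup₂_le fun s hs => le_iSup₂ (f := fun (s : Finset ℕ) (_ : ↑s ⊆ B) => μ s) s
    (hs.trans h)
  union_le' A B := by
    classical
    refine iSup₂_le fun s hs => ?_
    have hA : ((s.filter (· ∈ A) : Finset ℕ) : Set ℕ) ⊆ A := by intro n; simp
    have hB : ((s.filter (· ∈ B) : Finset ℕ) : Set ℕ) ⊆ B := by intro n; simp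
    calc μ s ≤ μ (((s.filter (· ∈ A) : Finset ℕ) : Set ℕ) ∪ (s.filter (· ∈ B) : Finset ℕ)) := by
          refine μ.mono fun n hn => ?_
          have hn' : n ∈ s := hn
          simpa [hn'] using hs hn
      _ ≤ _ := MeasureTheory.measure_union_le _ _
      _ ≤ _ := add_le_add
        (le_iSup₂ (f := fun (s : Finset ℕ) (_ : ↑s ⊆ A) => μ s) _ hA)
        (le_iSup₂ (f := fun (s : Finset ℕ) (_ : ↑s ⊆ B) => μ s) _ hB)
  singleton_lt_top' n := by
    refine lt_of_le_of_lt (iSup₂_le fun s hs => ?_) (hμ n)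
    exact μ.mono hs
  tendsto_iUnion' A hA := by
    have hmono : Monotone fun m => ⨆ (s : Finset ℕ) (_ : ↑s ⊆ A m), μ s := fun a b hab =>
      iSup₂_le fun s hs => le_iSup₂ (f := fun (s : Finset ℕ) (_ : ↑s ⊆ A b) => μ s) s
        (hs.trans (hA hab))
    convert tendsto_atTop_iSup hmono using 2
    refine le_antisymm (iSup₂_le fun s hs => ?_) (iSup_le fun m => iSup₂_le fun s hs => ?_)
    · obtain ⟨m, hm⟩ := hA.directed_le.exists_mem_subset_of_finset_subset_biUnion hs
      exact le_iSup_of_le m (le_iSup₂ (f := fun (s : Finset ℕ) (_ : ↑s ⊆ A m) => μ s) s hm)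
    · exact le_iSup₂ (f := fun (s : Finset ℕ) (_ : ↑s ⊆ ⋃ m, A m) => μ s) s
        (hs.trans (Set.subset_iUnion A m))

theorem LSCSubmeasure.ofOuterMeasure_le {μ : MeasureTheory.OuterMeasure ℕ}
    (hμ : ∀ n : ℕ, μ {n} < ∞) (A : Set ℕ) : (ofOuterMeasure μ hμ).toFun A ≤ μ A :=
  iSup₂_le fun _ hs => μ.mono hs

theorem LSCSubmeasure.le_ofOuterMeasure {μ : MeasureTheory.OuterMeasure ℕ}
    (hμ : ∀ n : ℕ, μ {n} < ∞) {A : Set ℕ} (s : Finset ℕ) (hs : ↑s ⊆ A) :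
    μ s ≤ (ofOuterMeasure μ hμ).toFun A :=
  le_iSup₂ (f := fun (s : Finset ℕ) (_ : ↑s ⊆ A) => μ s) s hs

/-- A `Σ⁰₂` `P`-ideal is represented by a lower semi-continuous submeasure all of whose small
sets belong to the ideal. -/
theorem exists_represents {I : Order.Ideal (Set ℕ)} (hσ : IsSigmaZeroTwo I) (hI : IsPIdeal I)
    (hfin : ContainsFin I) :
    ∃ φ : LSCSubmeasure, φ.Represents I ∧ ∀ A, φ.toFun A < 1 → A ∈ I := by
  obtain ⟨K, hK0, hK, hdisj, h3⟩ := exists_tailFamily_seq hσ hI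
  have h0 : ∀ n, ∅ ∈ K n := fun n => (hK n).empty_mem
  have hanti : Antitone K := antitone_nat_of_succ_le fun n A hA => by
    simpa using h3 n A hA A hA A hA
  set μ := MeasureTheory.OuterMeasure.ofFunction (familyWeight K) (familyWeight_empty h0)
  have hμ : ∀ n : ℕ, μ {n} < ∞ := fun n =>
    (MeasureTheory.OuterMeasure.ofFunction_le _).trans_lt (inf_le_right.trans_lt (by simp))
  have hfinite : ∀ (s : Finset ℕ) (m : ℕ), μ s < 2⁻¹ ^ m → (s : Set ℕ) ∈ K m := by
    intro s m hs
    rw [MeasureTheory.OuterMeasure.ofFunction_apply] at hs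
    obtain ⟨t, ht, hlt⟩ := by simpa only [iInf_lt_iff] using hs
    obtain ⟨F, hF, hsF⟩ := Set.finite_subset_iUnion s.finite_toSet ht
    -- Finitely many sets of the countable cover already cover `s`, so the finite chain argument
    -- applies.
    obtain ⟨N, hN⟩ := hF.bddAbove
    refine (hK m).lower _ (biUnion_Ico_mem_of_sum_familyWeight_lt hanti h0 h3 t (N + 1) 0 (N + 1) m
      rfl ((ENNReal.sum_le_tsum _).trans_lt hlt)) _ (hsF.trans ?_)
    exact Set.biUnion_subset_biUnion_left fun i hi => by
      simpa using Nat.lt_succ_of_le (hN hi)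
  -- Passing to suprema over finite sets provides lower semi-continuity. Nothing is lost, because
  -- membership in the closed family `K m` is tested on finite sets.
  set φ := LSCSubmeasure.ofOuterMeasure μ hμ
  have hmem : ∀ A m, φ.toFun A < 2⁻¹ ^ m → A ∈ K m := fun A m h =>
    (hK m).closed A fun s hs => hfinite s m ((LSCSubmeasure.le_ofOuterMeasure hμ s hs).trans_lt h)
  have hle : ∀ n, ∀ A ∈ K n, φ.toFun A ≤ 2⁻¹ ^ n := fun n A hA =>
    (LSCSubmeasure.ofOuterMeasure_le hμ A).trans
      ((MeasureTheory.OuterMeasure.ofFunction_le _).trans (familyWeight_le hA))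
  have hsmall : ∀ A, φ.toFun A < 1 → A ∈ I := fun A hA => hK0 (hmem A 0 (by simpa using hA))
  refine ⟨φ, ⟨fun n => ?_, fun A => ⟨fun hA => ?_, fun hA => ?_⟩⟩, hsmall⟩
  · by_contra hc
    have hn : ({n} : Set ℕ) ∈ K (n + 1) := hmem _ _ (by
      rw [nonpos_iff_eq_zero.1 (not_lt.1 hc)]
      exact ENNReal.pow_pos (by simp) _)
    exact Set.disjoint_left.1 (hdisj _ _ hn) (Set.mem_singleton n) (Set.mem_Iio.2 (Nat.lt_succ_self n))
  · rw [ENNReal.tendsto_atTop_zero]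
    intro ε hε
    obtain ⟨n, hn⟩ := ENNReal.exists_inv_two_pow_lt hε.ne'
    obtain ⟨N, hN⟩ := (hK n).tail A hA
    refine ⟨N, fun m hm => (hle n _ ((hK n).lower _ hN _ ?_)).trans hn.le⟩
    exact Set.sdiff_subset_sdiff_right fun x hx => ⟨Nat.zero_le _, (Set.mem_Iio.1 hx).le.trans hm⟩
  · obtain ⟨m, hm⟩ := (hA.eventually (gt_mem_nhds one_pos)).exists
    refine I.lower ?_ (Order.Ideal.sup_mem (hsmall _ hm) (hfin _ (Set.finite_Icc 0 m)))
    intro x hx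
    by_cases h : x ∈ Set.Icc 0 m
    · exact Or.inr h
    · exact Or.inl ⟨hx, h⟩

/-! ### `S_I` is a Polish group -/

/-- This permits the metric that compares both elements and inverses. The original metric may be
incomplete: a Cauchy sequence of permutations can converge to a non-surjective injection. -/
theorem topology_eq_induced_prodMk_inv {G : Type*} [Group G] [t : TopologicalSpace G]
    [IsTopologicalGroup G] :
    t = TopologicalSpace.induced (fun g : G => (g, g⁻¹)) instTopologicalSpaceProd := by
  refine le_antisymm (continuous_iff_le_induced.1 (continuous_id.prodMk continuous_inv)) ?_
  have h : (TopologicalSpace.induced (fun g : G => (g, g⁻¹)) instTopologicalSpaceProd) ≤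
      TopologicalSpace.induced ((Prod.fst : G × G → G) ∘ fun g : G => (g, g⁻¹)) t := by
    rw [← induced_compose]
    exact induced_mono (continuous_iff_le_induced.1 continuous_fst)
  exact h.trans induced_id.le

theorem isCompletelyMetrizableSpace_of_topology_eq {X : Type*} {t : TopologicalSpace X}
    (ht0 : T0Space X) {M : PseudoEMetricSpace X}
    (ht : t = M.toUniformSpace.toTopologicalSpace) (hc : @CompleteSpace X M.toUniformSpace) :
    @TopologicalSpace.IsCompletelyMetrizableSpace X t := by
  subst ht
  infer_instance

/-- A second countable group with a compatible metric is Polish if all sequences that are Cauchy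
fast, together with their inverses, converge. -/
theorem polishSpace_of_convergent_controlled_sequences {G : Type*} [Group G] [M : PseudoEMetricSpace G]
    [IsTopologicalGroup G] [T0Space G] [SecondCountableTopology G] (b : ℕ → ℝ≥0∞)
    (hb : ∀ k, 0 < b k)
    (H : ∀ u : ℕ → G, (∀ N n m, N ≤ n → N ≤ m → edist (u n) (u m) < b N) →
      (∀ N n m, N ≤ n → N ≤ m → edist (u n)⁻¹ (u m)⁻¹ < b N) → ∃ f, Tendsto u atTop (𝓝 f)) :
    PolishSpace G := by
  have htop : M.toUniformSpace.toTopologicalSpace =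
      TopologicalSpace.induced (fun g : G => (g, g⁻¹)) instTopologicalSpaceProd :=
    topology_eq_induced_prodMk_inv
  have hT0 : T0Space G := inferInstance
  have := @isCompletelyMetrizableSpace_of_topology_eq G _ hT0
    (PseudoEMetricSpace.induced (fun g : G => (g, g⁻¹)) inferInstance) htop ?_
  · infer_instance
  · refine @EMetric.complete_of_convergent_controlled_sequences _
      (PseudoEMetricSpace.induced (fun g : G => (g, g⁻¹)) inferInstance) b hb fun u hu => ?_
    obtain ⟨f, hf⟩ := H u
      (fun N n m hn hm => (le_max_left _ _).trans_lt (hu N n m hn hm))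
      (fun N n m hn hm => (le_max_right _ _).trans_lt (hu N n m hn hm))
    exact ⟨f, hf.mono_right (le_of_eq (congrArg (fun t => @nhds G t f) htop))⟩

namespace LSCSubmeasure.Represents

variable {φ : LSCSubmeasure} {I : Order.Ideal (Set ℕ)}

/-- Preimages under a member of `S_I` of small sets are small. -/
theorem exists_preimage_lt (h : φ.Represents I) (g : permGroup I) {ε : ℝ≥0∞} (hε : 0 < ε) :
    ∃ δ : ℝ≥0∞, 0 < δ ∧ ∀ A, φ.toFun A < δ → φ.toFun (g.1 ⁻¹' A) < ε := by
  obtain ⟨m, hm⟩ := h.exists_tail_lt g.2 (ENNReal.half_pos hε.ne')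
  -- Below this bound `A` contains no `g n` with `n ≤ m`. So the preimage avoids `[0, m]`, beyond
  -- which `g` moves only a small set.
  refine ⟨(Finset.Icc 0 m).inf (fun n => φ.toFun {g.1 n}) ⊓ (ε / 2), ?_, fun A hA => ?_⟩
  · exact lt_inf_iff.2 ⟨(Finset.lt_inf_iff (by simp)).2 fun n _ => h.1 _, ENNReal.half_pos hε.ne'⟩
  · have hsub : g.1 ⁻¹' A ⊆ A ∪ {n | g.1 n ≠ n} \ Set.Icc 0 m := by
      intro n hn
      have hnm : n ∉ Set.Icc 0 m := fun hnm => by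
        have h1 := hA.trans_le (inf_le_left.trans (Finset.inf_le (Finset.mem_Icc.2 hnm)))
        exact absurd h1 (not_lt.2 (φ.mono' _ _ (by simpa using hn)))
      by_cases hgn : g.1 n = n
      · exact Or.inl (by rw [← hgn]; exact hn)
      · exact Or.inr ⟨hgn, hnm⟩
    calc φ.toFun (g.1 ⁻¹' A) ≤ _ := φ.mono' _ _ hsub
      _ ≤ _ := φ.union_le' _ _
      _ < ε / 2 + ε / 2 := ENNReal.add_lt_add (hA.trans_le inf_le_right) hm
      _ = ε := ENNReal.add_halves ε

theorem tendsto_preimage (h : φ.Represents I) (g : permGroup I) {ι : Type*} {l : Filter ι}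
    {A : ι → Set ℕ} (hA : Tendsto (fun i => φ.toFun (A i)) l (𝓝 0)) :
    Tendsto (fun i => φ.toFun (g.1 ⁻¹' A i)) l (𝓝 0) := by
  rw [ENNReal.tendsto_nhds_zero]
  intro ε hε
  obtain ⟨δ, hδ, H⟩ := h.exists_preimage_lt g hε
  exact (hA.eventually (gt_mem_nhds hδ)).mono fun i hi => (H _ hi).le

theorem tendsto_iff {ι : Type*} {l : Filter ι} (u : ι → permGroup I) (f : permGroup I) :
    Tendsto u l (@nhds _ (φ.permMetric I).toUniformSpace.toTopologicalSpace f) ↔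
      Tendsto (fun i => φ.toFun {n | (u i).1 n ≠ f.1 n}) l (𝓝 0) :=
  @tendsto_iff_edist_tendsto_0 _ _ (φ.permMetric I) _ _ _

theorem isTopologicalGroup (h : φ.Represents I) :
    @IsTopologicalGroup (permGroup I) (φ.permMetric I).toUniformSpace.toTopologicalSpace _ := by
  let := φ.permMetric I
  refine @IsTopologicalGroup.mk _ _ _ ⟨?_⟩ ⟨?_⟩
  · refine continuous_iff_continuousAt.2 fun p => (tendsto_iff _ _).2 ?_
    have h1 := (tendsto_iff _ _).1 (continuous_fst.tendsto p)
    have h2 := (tendsto_iff _ _).1 (continuous_snd.tendsto p)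
    -- The set `{f g ≠ f' g'}` is contained in `{g ≠ g'} ∪ g'⁻¹ {f ≠ f'}`.
    have h3 := h2.add (h.tendsto_preimage p.2 h1)
    rw [add_zero] at h3
    refine tendsto_of_tendsto_of_tendsto_of_le_of_le tendsto_const_nhds h3
      (fun _ => zero_le) fun q => (φ.mono' _ _ ?_).trans (φ.union_le' _ _)
    intro n hn
    by_contra hc
    have hc' : q.2.1 n = p.2.1 n ∧ q.1.1 (p.2.1 n) = p.1.1 (p.2.1 n) := by
      simpa [not_or] using hc
    exact hn (by simp [hc'.1, hc'.2])
  · refine continuous_iff_continuousAt.2 fun f => (tendsto_iff _ _).2 ?_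
    have h1 := (tendsto_iff _ _).1 (continuous_id.tendsto f)
    -- The set `{g⁻¹ ≠ f⁻¹}` is exactly the preimage of `{g ≠ f}` under `f⁻¹`.
    refine (h.tendsto_preimage f⁻¹ h1).congr fun g => ?_
    congr 1
    ext n
    change g.1 (f.1.symm n) ≠ f.1 (f.1.symm n) ↔ g.1.symm n ≠ f.1.symm n
    rw [Equiv.apply_symm_apply, ne_comm, Ne, Ne, Equiv.symm_apply_eq]

theorem continuous_apply (h : φ.Represents I) (n : ℕ) :
    @Continuous _ _ (φ.permMetric I).toUniformSpace.toTopologicalSpace _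
      fun g : permGroup I => g.1 n := by
  let := φ.permMetric I
  refine continuous_iff_continuousAt.2 fun f => ?_
  rw [ContinuousAt, nhds_discrete ℕ, tendsto_pure]
  have h1 := (tendsto_iff _ _).1 (continuous_id.tendsto f)
  filter_upwards [h1.eventually (gt_mem_nhds (h.1 n))] with g hg
  by_contra hc
  exact absurd hg (not_lt.2 (φ.mono' _ _ (by simpa using hc)))

theorem t0Space (h : φ.Represents I) :
    @T0Space (permGroup I) (φ.permMetric I).toUniformSpace.toTopologicalSpace := by
  let := φ.permMetric I
  refine ⟨fun f g hfg => ?_⟩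
  ext n
  exact (hfg.map (h.continuous_apply n)).eq

theorem secondCountableTopology (h : φ.Represents I) :
    @SecondCountableTopology (permGroup I)
      (φ.permMetric I).toUniformSpace.toTopologicalSpace := by
  let := φ.permMetric I
  refine EMetric.secondCountable_of_almost_dense_set fun ε hε => ?_
  choose m hm using fun g : permGroup I => h.exists_tail_lt g.2 (ENNReal.half_pos hε.ne')
  -- One representative per code suffices: equal codes force agreement on `[0, m g]`, and both
  -- supports are small beyond it.
  set code : permGroup I → ℕ × List ℕ := fun g => (m g, (List.range (m g + 1)).map g.1)
  refine ⟨Set.range (Function.invFun code), Set.countable_range _, ?_⟩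
  refine Set.eq_univ_of_forall fun g => Set.mem_biUnion (Set.mem_range_self (code g)) ?_
  set f := Function.invFun code (code g)
  have hc : code f = code g := Function.invFun_eq ⟨g, rfl⟩
  have hmfg : m f = m g := congrArg Prod.fst hc
  have heq : ∀ n ≤ m g, f.1 n = g.1 n := by
    intro n hn
    have := congrArg Prod.snd hc
    simp only [code, hmfg] at this
    exact List.map_inj_left.1 this n (by simpa using Nat.lt_succ_of_le hn)
  change φ.toFun {n | g.1 n ≠ f.1 n} ≤ ε
  calc φ.toFun {n | g.1 n ≠ f.1 n}
      ≤ φ.toFun (({n | g.1 n ≠ n} \ Set.Icc 0 (m g)) ∪ ({n | f.1 n ≠ n} \ Set.Icc 0 (m f))) := by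
        refine φ.mono' _ _ fun n hn => ?_
        have hnm : n ∉ Set.Icc 0 (m g) := fun hnm => hn (heq n hnm.2).symm
        by_cases hgn : g.1 n = n
        · exact Or.inr ⟨fun hfn => hn (hgn.trans hfn.symm), hmfg ▸ hnm⟩
        · exact Or.inl ⟨hgn, hnm⟩
    _ ≤ _ := φ.union_le' _ _
    _ ≤ ε / 2 + ε / 2 := add_le_add (hm g).le (hm f).le
    _ = ε := ENNReal.add_halves ε

end LSCSubmeasure.Represents

/-- A Fatou property: a violation would already occur on a finite set, where `f` coincides with a
late `u n`. -/
theorem LSCSubmeasure.le_of_tendsto_pointwise (φ : LSCSubmeasure) {u : ℕ → ℕ → ℕ} {f N : ℕ → ℕ}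
    (hN : ∀ j n, N j ≤ n → u n j = f j) {b : ℝ≥0∞} {k : ℕ}
    (hb : ∀ n, k ≤ n → φ.toFun {j | u k j ≠ u n j} ≤ b) : φ.toFun {j | u k j ≠ f j} ≤ b := by
  by_contra hc
  obtain ⟨m, hm⟩ := φ.exists_finite_subset_lt (not_le.1 hc)
  obtain ⟨M, hM⟩ := ((Set.finite_Iic m).image N).bddAbove
  refine absurd (hm.trans_le (φ.mono' _ {j | u k j ≠ u (max k M) j} ?_))
    (not_lt.2 (hb _ (le_max_left _ _)))
  intro j hj
  have := hN j (max k M) ((hM ⟨j, hj.2, rfl⟩).trans (le_max_right _ _))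
  simpa [this] using hj.1

namespace LSCSubmeasure.Represents

variable {φ : LSCSubmeasure} {I : Order.Ideal (Set ℕ)}

theorem exists_forall_apply_eq (h : φ.Represents I) {u : ℕ → ℕ → ℕ}
    (hu : ∀ N n m, N ≤ n → N ≤ m → φ.toFun {j | u n j ≠ u m j} < 2⁻¹ ^ N) :
    ∃ f N : ℕ → ℕ, ∀ j n, N j ≤ n → u n j = f j := by
  choose N hN using fun j => ENNReal.exists_inv_two_pow_lt (h.1 j).ne'
  refine ⟨fun j => u (N j) j, N, fun j n hn => ?_⟩
  by_contra hc
  exact absurd ((hu (N j) n (N j) hn le_rfl).trans (hN j)) (not_lt.2 (φ.mono' _ _ (by simpa using hc)))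

/-- The pointwise limits of the sequence and of its inverses are inverse to each other, so the limit
is a permutation. Its support is in `I`, since it is close to elements whose supports have small
tails. -/
theorem exists_limit (h : φ.Represents I) (u : ℕ → permGroup I)
    (hu : ∀ N n m, N ≤ n → N ≤ m → φ.toFun {j | (u n).1 j ≠ (u m).1 j} < 2⁻¹ ^ N)
    (hu' : ∀ N n m, N ≤ n → N ≤ m → φ.toFun {j | (u n)⁻¹.1 j ≠ (u m)⁻¹.1 j} < 2⁻¹ ^ N) :
    ∃ f : permGroup I, ∀ k, φ.toFun {j | (u k).1 j ≠ f.1 j} ≤ 2⁻¹ ^ k := by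
  obtain ⟨f, N, hf⟩ := h.exists_forall_apply_eq hu
  obtain ⟨f', N', hf'⟩ := h.exists_forall_apply_eq hu'
  have hlim : ∀ k, φ.toFun {j | (u k).1 j ≠ f j} ≤ 2⁻¹ ^ k := fun k =>
    φ.le_of_tendsto_pointwise (u := fun n j => (u n).1 j) hf fun n hn => (hu k k n le_rfl hn).le
  let F : Equiv.Perm ℕ :=
    { toFun := f
      invFun := f'
      left_inv := fun j => by
        rw [← hf j (max (N j) (N' (f j))) (le_max_left _ _),
          ← hf' _ (max (N j) (N' (f j))) (by
            rw [hf j (max (N j) (N' (f j))) (le_max_left _ _)]; exact le_max_right _ _)]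
        simp
      right_inv := fun j => by
        rw [← hf' j (max (N' j) (N (f' j))) (le_max_left _ _),
          ← hf _ (max (N' j) (N (f' j))) (by
            rw [hf' j (max (N' j) (N (f' j))) (le_max_left _ _)]; exact le_max_right _ _)]
        simp }
  have hF : F ∈ permGroup I := by
    refine h.mem_of_forall_tail_le fun ε hε => ?_
    obtain ⟨k, hk⟩ := ENNReal.exists_inv_two_pow_lt (ENNReal.half_pos hε.ne').ne'
    obtain ⟨m, hm⟩ := h.exists_tail_lt (u k).2 (ENNReal.half_pos hε.ne')
    refine ⟨m, ?_⟩
    calc _ ≤ φ.toFun ({j | (u k).1 j ≠ f j} ∪ ({n | (u k).1 n ≠ n} \ Set.Icc 0 m)) := by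
          refine φ.mono' _ _ fun n hn => ?_
          by_cases hc : (u k).1 n = f n
          · exact Or.inr ⟨fun hk => hn.1 (hc.symm.trans hk), hn.2⟩
          · exact Or.inl hc
      _ ≤ _ := φ.union_le' _ _
      _ ≤ ε / 2 + ε / 2 := add_le_add ((hlim k).trans hk.le) hm.le
      _ = ε := ENNReal.add_halves ε
  exact ⟨⟨F, hF⟩, hlim⟩

theorem polishSpace (h : φ.Represents I) :
    @PolishSpace (permGroup I) (φ.permMetric I).toUniformSpace.toTopologicalSpace := by
  let M := φ.permMetric I
  have := h.isTopologicalGroup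
  have := h.t0Space
  have := h.secondCountableTopology
  refine polishSpace_of_convergent_controlled_sequences (fun k => 2⁻¹ ^ k)
    (fun k => ENNReal.pow_pos (by simp) k) fun u hu hu' => ?_
  obtain ⟨f, hf⟩ := h.exists_limit u hu hu'
  exact ⟨f, (tendsto_iff _ _).2 (tendsto_of_tendsto_of_tendsto_of_le_of_le tendsto_const_nhds
    (ENNReal.tendsto_pow_atTop_nhds_zero_of_lt_one (r := 2⁻¹) (by simp)) (fun _ => zero_le) hf)⟩

end LSCSubmeasure.Represents

/-! ### Consequences of not being a trivial modification of `Fin` -/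

namespace LSCSubmeasure

variable {φ : LSCSubmeasure} {I : Order.Ideal (Set ℕ)}

/-- The points of `A` have arbitrarily small submeasure. -/
def VanishesAlong (φ : LSCSubmeasure) (A : Set ℕ) : Prop :=
  ∀ ε : ℝ≥0∞, 0 < ε → {a ∈ A | ε ≤ φ.toFun {a}}.Finite

/-- If the set `E k` of points lighter than `2⁻¹ ^ k` were in `I`, its complement would exhibit `I`
as a trivial modification. So no tail of `E k` is in `I`, all have submeasure at least `1`, and
finite pieces of submeasure above `2⁻¹`, taken ever further out, unite to `A`. -/
theorem Represents.exists_notMem_vanishesAlong (h : φ.Represents I)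
    (hsmall : ∀ A, φ.toFun A < 1 → A ∈ I) (hI : ¬ IsTrivialModificationOfFin I) :
    ∃ A ∉ I, φ.VanishesAlong A := by
  set E : ℕ → Set ℕ := fun k => {n | φ.toFun {n} < 2⁻¹ ^ k}
  have hE : ∀ k, E k ∉ I := by
    intro k hk
    refine hI ⟨(E k)ᶜ, fun B => ⟨fun hB => ?_, fun hB => ?_⟩⟩
    · obtain ⟨m, hm⟩ := h.exists_tail_lt hB (ENNReal.pow_pos (a := 2⁻¹) (by simp) k)
      refine (Set.finite_Icc 0 m).subset fun n hn => ?_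
      by_contra hc
      exact hn.1 ((φ.mono' _ _ (Set.singleton_subset_iff.2 (show n ∈ B \ Set.Icc 0 m from ⟨hn.2, hc⟩))).trans_lt hm)
    · refine I.lower ?_ (Order.Ideal.sup_mem (h.mem_of_finite hB) hk)
      intro n hn
      by_cases hnE : n ∈ E k
      · exact Or.inr hnE
      · exact Or.inl ⟨hnE, hn⟩
  have hlt : ∀ k, (2⁻¹ : ℝ≥0∞) < φ.toFun (E k \ Set.Icc 0 k) := by
    intro k
    refine lt_of_lt_of_le (b := 1) (by simp) (not_lt.1 fun hc => hE k ?_)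
    refine I.lower ?_ (Order.Ideal.sup_mem (hsmall _ hc) (h.mem_of_finite (Set.finite_Icc 0 k)))
    intro n hn
    by_cases hnk : n ∈ Set.Icc 0 k
    · exact Or.inr hnk
    · exact Or.inl ⟨hn, hnk⟩
  choose m hm using fun k => φ.exists_finite_subset_lt (hlt k)
  refine ⟨⋃ k, (E k \ Set.Icc 0 k) ∩ Set.Iic (m k), fun hA => ?_, fun ε hε => ?_⟩
  · obtain ⟨k, hk⟩ := h.exists_tail_lt hA (ε := 2⁻¹) (by simp)
    refine absurd ((hm k).trans_le (φ.mono' _ _ fun n hn => ?_)) (not_lt.2 hk.le)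
    exact ⟨Set.mem_iUnion.2 ⟨k, hn⟩, hn.1.2⟩
  · obtain ⟨k, hk⟩ := ENNReal.exists_inv_two_pow_lt hε.ne'
    refine ((Set.finite_Iio k).biUnion fun j _ => Set.finite_Iic (m j)).subset ?_
    rintro a ⟨ha, hεa⟩
    obtain ⟨j, hj⟩ := Set.mem_iUnion.1 ha
    refine Set.mem_biUnion (x := j) (Set.mem_Iio.2 ?_) hj.2
    by_contra hc
    have h1 : φ.toFun {a} < 2⁻¹ ^ j := hj.1.1
    have h2 : (2⁻¹ : ℝ≥0∞) ^ j ≤ 2⁻¹ ^ k := pow_le_pow_right_of_le_one' (by simp) (not_lt.1 hc)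
    exact absurd (h1.trans_le (h2.trans hk.le)) (not_lt.2 hεa)

/-- Choosing points of `A \ J` with summable submeasures gives `W`. It provides the free room in
which actions are modified and matched. -/
theorem Represents.exists_infinite_mem_disjoint (h : φ.Represents I) {A J : Set ℕ} (hA : A ∉ I)
    (hφA : φ.VanishesAlong A) (hJ : J ∈ I) : ∃ W ∈ I, W.Infinite ∧ Disjoint W J := by
  have hinf : (A \ J).Infinite := fun hf => hA <| by
    refine I.lower ?_ (Order.Ideal.sup_mem (h.mem_of_finite hf) hJ)
    intro n hn
    by_cases hnJ : n ∈ J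
    · exact Or.inr hnJ
    · exact Or.inl ⟨hn, hnJ⟩
  have hex : ∀ k : ℕ, ∃ b ∈ A \ J, k ≤ b ∧ φ.toFun {b} < 2⁻¹ ^ k := by
    intro k
    obtain ⟨b, hb, hbn⟩ := (hinf.sdiff ((hφA _ (ENNReal.pow_pos (a := 2⁻¹) (by simp) k)).union
      (Set.finite_Iio k))).nonempty
    refine ⟨b, hb, ?_, ?_⟩
    · by_contra hc
      exact hbn (Or.inr (not_le.1 hc))
    · by_contra hc
      exact hbn (Or.inl ⟨hb.1, not_lt.1 hc⟩)
  choose b hb hkb hφb using hex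
  refine ⟨⋃ k, {b k}, h.iUnion_mem _ (fun k => Set.finite_singleton _) ?_, ?_, ?_⟩
  · refine ne_top_of_le_ne_top ?_ (ENNReal.tsum_le_tsum fun k => (hφb k).le)
    rw [ENNReal.tsum_geometric]
    simp
  · refine Set.infinite_of_not_bddAbove fun ⟨m, hm⟩ => ?_
    have := hm (Set.mem_iUnion.2 ⟨m + 1, rfl⟩)
    have := hkb (m + 1)
    omega
  · rw [Set.disjoint_left]
    intro n hn
    obtain ⟨k, rfl⟩ := Set.mem_iUnion.1 hn
    exact (hb k).2

theorem Represents.tendsto_iUnion_diff (h : φ.Represents I) {D : ℕ → Set ℕ} (hD : Monotone D)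
    (hDI : (⋃ k, D k) ∈ I) : Tendsto (fun k => φ.toFun ((⋃ j, D j) \ D k)) atTop (𝓝 0) := by
  rw [ENNReal.tendsto_nhds_zero]
  intro ε hε
  obtain ⟨m, hm⟩ := h.exists_tail_lt hDI hε
  obtain ⟨k₀, hk₀⟩ : ∃ k₀, (⋃ j, D j) ∩ Set.Icc 0 m ⊆ D k₀ := by
    have hfin : ((⋃ j, D j) ∩ Set.Icc 0 m).Finite := (Set.finite_Icc 0 m).inter_of_right _
    obtain ⟨k₀, hk₀⟩ := hD.directed_le.exists_mem_subset_of_finset_subset_biUnion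
      (s := hfin.toFinset) (by simp)
    exact ⟨k₀, by simpa using hk₀⟩
  filter_upwards [eventually_ge_atTop k₀] with k hk
  refine (φ.mono' _ _ ?_).trans hm.le
  exact fun n hn => ⟨hn.1, fun hnm => hn.2 (hD hk (hk₀ ⟨hn.1, hnm⟩))⟩

end LSCSubmeasure

/-! ### Products of transpositions and the failure of zero-dimensionality -/

open Classical in
/-- The involution that interchanges `2 * k` and `2 * k + 1` for `k ∈ B`. -/
noncomputable def flipPairs (B : Set ℕ) : Equiv.Perm ℕ :=
  Function.Involutive.toPerm
    (fun i => if i / 2 ∈ B then (if i % 2 = 0 then i + 1 else i - 1) else i) (by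
      intro i
      dsimp only
      by_cases hB : i / 2 ∈ B
      · rcases Nat.mod_two_eq_zero_or_one i with h | h
        · have h1 : (i + 1) / 2 = i / 2 := by omega
          have h2 : ¬ ((i + 1) % 2 = 0) := by omega
          simp [hB, h, h1, h2]
        · have h1 : (i - 1) / 2 = i / 2 := by omega
          have h2 : (i - 1) % 2 = 0 := by omega
          simp only [hB, if_true, h, one_ne_zero, if_false, h1, h2]
          omega
      · simp [hB])

theorem flipPairs_apply_of_notMem {B : Set ℕ} {i : ℕ} (h : i / 2 ∉ B) : flipPairs B i = i := by
  exact if_neg h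

theorem flipPairs_apply_of_mem {B : Set ℕ} {i : ℕ} (h : i / 2 ∈ B) :
    flipPairs B i = if i % 2 = 0 then i + 1 else i - 1 := by
  exact if_pos h

theorem flipPairs_ne_flipPairs_iff {B C : Set ℕ} {i : ℕ} :
    flipPairs B i ≠ flipPairs C i ↔ i / 2 ∈ symmDiff B C := by
  rw [Set.mem_symmDiff]
  have hne : (if i % 2 = 0 then i + 1 else i - 1) ≠ i := by
    split_ifs <;> omega
  by_cases hB : i / 2 ∈ B <;> by_cases hC : i / 2 ∈ C <;>
    simp [flipPairs_apply_of_mem, flipPairs_apply_of_notMem, hB, hC, hne, hne.symm]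

/-- The product of the transpositions of `a (2 * k)` and `a (2 * k + 1)` for `k ∈ B`. -/
noncomputable def swapPairs (a : ℕ ↪ ℕ) (B : Set ℕ) : Equiv.Perm ℕ :=
  (flipPairs B).viaEmbedding a

/-- The set of all `a (2 * k)` and `a (2 * k + 1)` for `k ∈ B`. -/
def pairs (a : ℕ ↪ ℕ) (B : Set ℕ) : Set ℕ := a '' {i | i / 2 ∈ B}

theorem setOf_swapPairs_ne (a : ℕ ↪ ℕ) (B C : Set ℕ) :
    {n | swapPairs a B n ≠ swapPairs a C n} = pairs a (symmDiff B C) := by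
  ext n
  by_cases hn : n ∈ Set.range a
  · obtain ⟨i, rfl⟩ := hn
    simp only [Set.mem_ofPred_eq, swapPairs, Equiv.Perm.viaEmbedding_apply, pairs,
      a.injective.mem_set_image, ne_eq, a.apply_eq_iff_eq]
    exact flipPairs_ne_flipPairs_iff
  · simp only [Set.mem_ofPred_eq, swapPairs, Equiv.Perm.viaEmbedding_apply_of_notMem _ _ _ hn, ne_eq,
      not_true, false_iff]
    rintro ⟨i, _, rfl⟩
    exact hn ⟨i, rfl⟩

theorem swapPairs_empty (a : ℕ ↪ ℕ) : swapPairs a ∅ = 1 := by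
  ext n
  by_cases hn : n ∈ Set.range a
  · obtain ⟨i, rfl⟩ := hn
    simp [swapPairs, Equiv.Perm.viaEmbedding_apply, flipPairs_apply_of_notMem]
  · simp [swapPairs, Equiv.Perm.viaEmbedding_apply_of_notMem _ _ _ hn]

theorem setOf_swapPairs_ne_self (a : ℕ ↪ ℕ) (B : Set ℕ) :
    {n | swapPairs a B n ≠ n} = pairs a B := by
  have := setOf_swapPairs_ne a B ∅
  rw [swapPairs_empty] at this
  simpa [symmDiff_def] using this

theorem pairs_mono (a : ℕ ↪ ℕ) : Monotone (pairs a) := fun _ _ h =>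
  Set.image_mono fun _ hi => h hi

theorem pairs_union (a : ℕ ↪ ℕ) (B C : Set ℕ) : pairs a (B ∪ C) = pairs a B ∪ pairs a C := by
  rw [pairs, pairs, pairs, ← Set.image_union]
  rfl

theorem pairs_diff (a : ℕ ↪ ℕ) (B C : Set ℕ) : pairs a (B \ C) = pairs a B \ pairs a C := by
  rw [pairs, pairs, pairs, ← Set.image_sdiff a.injective]
  rfl

theorem pairs_iUnion (a : ℕ ↪ ℕ) (B : ℕ → Set ℕ) : pairs a (⋃ k, B k) = ⋃ k, pairs a (B k) := by
  simp only [pairs, ← Set.image_iUnion]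
  congr 1
  ext i
  simp

theorem pairs_univ (a : ℕ ↪ ℕ) : pairs a Set.univ = Set.range a := by
  simp [pairs]

theorem pairs_singleton (a : ℕ ↪ ℕ) (k : ℕ) : pairs a {k} = {a (2 * k), a (2 * k + 1)} := by
  have : {i | i / 2 ∈ ({k} : Set ℕ)} = {2 * k, 2 * k + 1} := by
    ext i
    simp only [Set.mem_ofPred_eq, Set.mem_singleton_iff, Set.mem_insert_iff]
    omega
  rw [pairs, this, Set.image_pair]

theorem Set.Finite.pairs {B : Set ℕ} (hB : B.Finite) (a : ℕ ↪ ℕ) : (pairs a B).Finite := by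
  obtain ⟨m, hm⟩ := hB.bddAbove
  refine ((Set.finite_Iic (2 * m + 1)).subset fun i hi => ?_).image a
  have := hm hi
  simp only [Set.mem_Iic]
  omega

namespace LSCSubmeasure

variable {φ : LSCSubmeasure} {I : Order.Ideal (Set ℕ)}

theorem VanishesAlong.tendsto_pairs {A : Set ℕ} (hA : φ.VanishesAlong A) (a : ℕ ↪ ℕ)
    (ha : ∀ i, a i ∈ A) : Tendsto (fun k => φ.toFun (pairs a {k})) atTop (𝓝 0) := by
  have h0 : Tendsto (fun i => φ.toFun {a i}) atTop (𝓝 0) := by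
    rw [ENNReal.tendsto_nhds_zero]
    intro ε hε
    have hfin : {i | ε ≤ φ.toFun {a i}}.Finite :=
      ((hA ε hε).preimage a.injective.injOn).subset fun i hi => ⟨ha i, hi⟩
    have := hfin.eventually_cofinite_notMem
    rw [Nat.cofinite_eq_atTop] at this
    filter_upwards [this] with i hi
    exact (not_le.1 hi).le
  have h1 : Tendsto (fun k : ℕ => 2 * k) atTop atTop :=
    tendsto_atTop_mono (fun k => (by omega : k ≤ 2 * k)) tendsto_id
  have h2 : Tendsto (fun k : ℕ => 2 * k + 1) atTop atTop :=
    tendsto_atTop_mono (fun k => (by omega : k ≤ 2 * k + 1)) tendsto_id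
  have h3 := (h0.comp h1).add (h0.comp h2)
  rw [add_zero] at h3
  refine tendsto_of_tendsto_of_tendsto_of_le_of_le tendsto_const_nhds h3 (fun _ => zero_le)
    fun k => ?_
  change φ.toFun (pairs a {k}) ≤ _
  rw [pairs_singleton, Set.insert_eq]
  exact φ.union_le' _ _

/-- No clopen neighbourhood of the identity of `S_I` is contained in a small ball. -/
theorem Represents.exists_le_of_isClopen (h : φ.Represents I)
    (hsmall : ∀ A, φ.toFun A < 1 → A ∈ I) (hI : ¬ IsTrivialModificationOfFin I)
    {U : Set (permGroup I)}
    (hU : @IsClopen _ (φ.permMetric I).toUniformSpace.toTopologicalSpace U) (h1 : 1 ∈ U) :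
    ∃ g ∈ U, 2⁻¹ ≤ φ.toFun {n | g.1 n ≠ n} := by
  classical
  let M := φ.permMetric I
  by_contra! hcon
  obtain ⟨A, hA, hφA⟩ := h.exists_notMem_vanishesAlong hsmall hI
  have hAinf : Infinite A := Set.infinite_coe_iff.2 fun hf => hA (h.mem_of_finite hf)
  set a : ℕ ↪ ℕ := (Nat.orderEmbeddingOfSet A).toEmbedding
  have hrange : Set.range a = A := Nat.orderEmbeddingOfSet_range A
  have haA : ∀ i, a i ∈ A := fun i => hrange ▸ Set.mem_range_self i
  have hmem : ∀ B, pairs a B ∈ I → swapPairs a B ∈ permGroup I := fun B hB => by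
    change {n | swapPairs a B n ≠ n} ∈ I
    rwa [setOf_swapPairs_ne_self]
  set Good : Set ℕ → Prop := fun B => ∃ hB : pairs a B ∈ I, (⟨_, hmem B hB⟩ : permGroup I) ∈ U
  have hlt : ∀ B, Good B → φ.toFun (pairs a B) < 2⁻¹ := by
    rintro B ⟨hB, hBU⟩
    have := hcon _ hBU
    rwa [setOf_swapPairs_ne_self] at this
  -- By lower semi-continuity the limit has submeasure at most `2⁻¹ < 1`, so it is still in `I`.
  have hunion : ∀ B : ℕ → Set ℕ, Monotone B → (∀ k, Good (B k)) → pairs a (⋃ k, B k) ∈ I := by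
    intro B hB hgood
    refine hsmall _ (lt_of_le_of_lt ?_ (by simp : (2⁻¹ : ℝ≥0∞) < 1))
    rw [pairs_iUnion]
    exact le_of_tendsto' (φ.tendsto_iUnion' _ ((pairs_mono a).comp hB)) fun k => (hlt _ (hgood k)).le
  -- Add pairs one after another, starting where they are lighter than `2⁻¹ ^ k`. If `U` were never
  -- left, almost all of `A` would be in `I`. So there is a last good stage `C`, and one light pair
  -- `j` leads out of `U`.
  have step : ∀ (k : ℕ) (B : {B : Set ℕ // Good B ∧ B.Finite}),
      ∃ (C : {B : Set ℕ // Good B ∧ B.Finite}) (j : ℕ), B.1 ⊆ C.1 ∧ ¬ Good (C.1 ∪ {j}) ∧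
        φ.toFun (pairs a {j}) < 2⁻¹ ^ k := by
    rintro k ⟨B, hB, hBfin⟩
    obtain ⟨N, hN⟩ := eventually_atTop.1 ((hφA.tendsto_pairs a haA).eventually
      (gt_mem_nhds (ENNReal.pow_pos (a := 2⁻¹) (by simp) k)))
    set D : ℕ → Set ℕ := fun i => B ∪ Set.Ico N (N + i)
    have hD : Monotone D := fun i i' hi =>
      Set.union_subset_union_right _ (Set.Ico_subset_Ico_right (by omega))
    have hDsucc : ∀ i, D (i + 1) = D i ∪ {N + i} := by
      intro i
      ext x
      simp only [D, Set.mem_union, Set.mem_Ico, Set.mem_singleton_iff]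
      have : (N ≤ x ∧ x < N + (i + 1)) ↔ ((N ≤ x ∧ x < N + i) ∨ x = N + i) := by omega
      rw [this, or_assoc]
    have hex : ∃ i, ¬ Good (D i) := by
      by_contra! hall
      refine hA (hrange ▸ pairs_univ a ▸ I.lower ?_ (Order.Ideal.sup_mem (hunion D hD hall)
        (h.mem_of_finite ((Set.finite_Iio N).pairs a))))
      change _ ⊆ pairs a _ ∪ pairs a _
      rw [← pairs_union]
      refine pairs_mono a fun x _ => ?_
      rcases lt_or_ge x N with hx | hx
      · exact Or.inr hx
      · exact Or.inl (Set.mem_iUnion.2 ⟨x - N + 1, Or.inr ⟨hx, by omega⟩⟩)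
    have hspec := Nat.find_spec hex
    have hmin := fun m => Nat.find_min (H := hex) (m := m)
    obtain ⟨i, hi⟩ : ∃ i, Nat.find hex = i + 1 := Nat.exists_eq_succ_of_ne_zero fun h0 => by
      rw [h0] at hspec
      exact hspec (by simpa [D] using hB)
    rw [hi] at hspec
    refine ⟨⟨D i, not_not.1 (hmin i (by omega)), hBfin.union (Set.finite_Ico _ _)⟩, N + i,
      Set.subset_union_left, ?_, hN _ (by omega)⟩
    rwa [← hDsucc]
  choose f j hsub hbad hj using step
  have hgood0 : Good ∅ := by
    refine ⟨by simpa [pairs] using I.bot_mem, ?_⟩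
    convert h1
    exact swapPairs_empty a
  let B : ℕ → {B : Set ℕ // Good B ∧ B.Finite} := fun k =>
    Nat.rec ⟨∅, hgood0, Set.finite_empty⟩ (fun k B => f k B) k
  have hBmono : Monotone fun k => (B k).1 := monotone_nat_of_le_succ fun k => hsub k (B k)
  have hinf := hunion _ hBmono fun k => (B k).2.1
  set Binf : Set ℕ := ⋃ k, (B k).1
  set ginf : permGroup I := ⟨_, hmem Binf hinf⟩
  have hlim : ∀ C : ℕ → Set ℕ, ∀ hC : ∀ k, pairs a (C k) ∈ I,
      Tendsto (fun k => φ.toFun (pairs a (symmDiff (C k) Binf))) atTop (𝓝 0) →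
      Tendsto (fun k => (⟨_, hmem _ (hC k)⟩ : permGroup I)) atTop (𝓝 ginf) := by
    intro C hC hlim
    refine (tendsto_iff _ _).2 (hlim.congr fun k => ?_)
    rw [← setOf_swapPairs_ne]
  have hdiff : Tendsto (fun k => φ.toFun (pairs a (Binf \ (B k).1))) atTop (𝓝 0) := by
    have := h.tendsto_iUnion_diff ((pairs_mono a).comp hBmono)
      (by rw [pairs_iUnion] at hinf; exact hinf)
    refine this.congr fun k => ?_
    rw [pairs_diff, pairs_iUnion]
    rfl
  -- The good stages converge to `ginf`. So do their bad neighbours, which differ from them by ever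
  -- lighter pairs.
  have hin : ginf ∈ U := by
    refine hU.1.mem_of_tendsto (hlim (fun k => (B k).1) (fun k => (B k).2.1.1)
      (hdiff.congr fun k => ?_)) (Eventually.of_forall fun k => (B k).2.1.2)
    rw [symmDiff_of_le (Set.subset_iUnion (fun k => (B k).1) k)]
  have hCI : ∀ k, pairs a ((B (k + 1)).1 ∪ {j k (B k)}) ∈ I := fun k =>
    h.mem_of_finite (((B (k + 1)).2.2.union (Set.finite_singleton _)).pairs a)
  have hout : ginf ∈ Uᶜ := by
    refine hU.compl.1.mem_of_tendsto (hlim (fun k => (B (k + 1)).1 ∪ {j k (B k)}) hCI ?_)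
      (Eventually.of_forall fun k hk => hbad k (B k) ⟨hCI k, hk⟩)
    have h2 : Tendsto (fun k => φ.toFun (pairs a (Binf \ (B (k + 1)).1)) + 2⁻¹ ^ k) atTop (𝓝 0) := by
      have := (hdiff.comp (tendsto_add_atTop_nat 1)).add
        (ENNReal.tendsto_pow_atTop_nhds_zero_of_lt_one (r := 2⁻¹) (by simp))
      rwa [add_zero] at this
    refine tendsto_of_tendsto_of_tendsto_of_le_of_le tendsto_const_nhds h2 (fun _ => zero_le)
      fun k => ?_
    refine le_trans (φ.mono' _ (pairs a (Binf \ (B (k + 1)).1) ∪ pairs a {j k (B k)}) ?_)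
      ((φ.union_le' _ _).trans (add_le_add le_rfl (hj k (B k)).le))
    rw [← pairs_union]
    refine pairs_mono a fun x hx => ?_
    rcases hx with ⟨hx | hx, hn⟩ | ⟨hx, hn⟩
    · exact absurd (Set.mem_iUnion.2 ⟨k + 1, hx⟩) hn
    · exact Or.inr hx
    · exact Or.inl ⟨hx, fun hB => hn (Or.inl hB)⟩
  exact hout hin

theorem Represents.setOf_lt_mem_nhds_one (φ : LSCSubmeasure) (I : Order.Ideal (Set ℕ)) :
    {g : permGroup I | φ.toFun {n | g.1 n ≠ n} < 2⁻¹} ∈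
      @nhds _ (φ.permMetric I).toUniformSpace.toTopologicalSpace 1 :=
  @Metric.eball_mem_nhds _ (φ.permMetric I) 1 2⁻¹ (by simp)

theorem Represents.not_exists_isClopen_subset (h : φ.Represents I)
    (hsmall : ∀ A, φ.toFun A < 1 → A ∈ I) (hI : ¬ IsTrivialModificationOfFin I)
    {U : Set (permGroup I)}
    (hU : @IsClopen _ (φ.permMetric I).toUniformSpace.toTopologicalSpace U) (h1 : 1 ∈ U) :
    ¬ U ⊆ {g : permGroup I | φ.toFun {n | g.1 n ≠ n} < 2⁻¹} := fun hsub =>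
  let ⟨_, hg, hle⟩ := h.exists_le_of_isClopen hsmall hI hU h1
  absurd (hsub hg) (not_lt.2 hle)

theorem Represents.not_isZeroDimensional (h : φ.Represents I)
    (hsmall : ∀ A, φ.toFun A < 1 → A ∈ I) (hI : ¬ IsTrivialModificationOfFin I) :
    ¬ @IsZeroDimensional (permGroup I) (φ.permMetric I).toUniformSpace.toTopologicalSpace := by
  let M := φ.permMetric I
  intro hz
  obtain ⟨U, hU, h1, hsub⟩ := hz.mem_nhds_iff.1 (setOf_lt_mem_nhds_one φ I)
  exact h.not_exists_isClopen_subset hsmall hI hU h1 hsub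

theorem Represents.not_nonarchimedeanGroup (h : φ.Represents I)
    (hsmall : ∀ A, φ.toFun A < 1 → A ∈ I) (hI : ¬ IsTrivialModificationOfFin I) :
    ¬ @NonarchimedeanGroup (permGroup I) _
      (φ.permMetric I).toUniformSpace.toTopologicalSpace := by
  let M := φ.permMetric I
  intro hz
  obtain ⟨V, hV⟩ := hz.is_nonarchimedean _ (setOf_lt_mem_nhds_one φ I)
  exact h.not_exists_isClopen_subset hsmall hI V.isClopen V.one_mem hV

theorem Represents.not_isNonArchimedean (h : φ.Represents I)
    (hsmall : ∀ A, φ.toFun A < 1 → A ∈ I) (hI : ¬ IsTrivialModificationOfFin I) :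
    ¬ @IsNonArchimedean (permGroup I) _
      (φ.permMetric I).toUniformSpace.toTopologicalSpace := by
  let M := φ.permMetric I
  rintro ⟨j, hj⟩
  have hnhds := setOf_lt_mem_nhds_one φ I
  rw [hj.nhds_eq_comap, nhds_pi, mem_comap] at hnhds
  obtain ⟨S, hS, hsub⟩ := hnhds
  obtain ⟨F, hF, t, ht, htS⟩ := Filter.mem_pi.1 hS
  refine h.not_exists_isClopen_subset hsmall hI (U := ⋂ i ∈ F, {g | j g i ∈ t i}) ?_ ?_
    fun g hg => hsub (htS fun i hi => ?_)
  · refine hF.isClopen_biInter fun i _ => ?_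
    exact (isClopen_discrete (t i)).preimage ((_root_.continuous_apply i).comp hj.continuous)
  · exact Set.mem_iInter₂.2 fun i _ => show j 1 i ∈ t i from mem_of_mem_nhds (ht i)
  · exact Set.mem_iInter₂.1 hg i hi

end LSCSubmeasure

/-! ### Isomorphism of actions with finite orbits -/

section Equivariant

variable (H : Type*) [Group H]

/-- The set of all stabilizers of the points of an orbit. -/
def orbitType {X : Type*} [MulAction H X] (ω : MulAction.orbitRel.Quotient H X) :
    Set (Subgroup H) :=
  {K | ∃ x : X, Quotient.mk _ x = ω ∧ MulAction.stabilizer H x = K}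

theorem orbitType_mk {X : Type*} [MulAction H X] (x : X) :
    orbitType H (Quotient.mk _ x : MulAction.orbitRel.Quotient H X) =
      Set.range fun h : H => (MulAction.stabilizer H x).map (MulAut.conj h).toMonoidHom := by
  ext K
  constructor
  · rintro ⟨y, hy, rfl⟩
    obtain ⟨h, rfl⟩ : y ∈ MulAction.orbit H x := MulAction.orbitRel_apply.1 (Quotient.exact hy)
    exact ⟨h, (MulAction.stabilizer_smul_eq_stabilizer_map_conj h x).symm⟩
  · rintro ⟨h, rfl⟩
    exact ⟨h • x, Quotient.sound (MulAction.orbitRel_apply.2 ⟨h, rfl⟩),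
      MulAction.stabilizer_smul_eq_stabilizer_map_conj h x⟩

/-- Finite orbits cannot absorb infinitely many points with stabilizer `K`, so infinitely many
orbits are needed. -/
theorem infinite_setOf_orbitType_eq {X : Type*} [MulAction H X]
    (hX : ∀ x : X, (MulAction.orbit H x).Finite) {K : Subgroup H}
    (hK : {x : X | MulAction.stabilizer H x = K}.Infinite) :
    {ω : MulAction.orbitRel.Quotient H X | orbitType H ω =
      Set.range fun h : H => K.map (MulAut.conj h).toMonoidHom}.Infinite := by
  intro hfin
  refine hK ((hfin.preimage' (f := Quotient.mk _) fun ω _ => ?_).subset ?_)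
  · induction ω using Quotient.inductionOn with
    | _ x =>
      exact (hX x).subset fun y hy => MulAction.orbitRel_apply.1 (Quotient.exact hy)
  · rintro x rfl
    exact orbitType_mk H x

theorem finiteIndex_stabilizer {X : Type*} [MulAction H X] {x : X}
    (hx : (MulAction.orbit H x).Finite) : (MulAction.stabilizer H x).FiniteIndex := by
  refine ⟨?_⟩
  rw [MulAction.index_stabilizer]
  exact ((Set.ncard_pos hx).2 (MulAction.nonempty_orbit x)).ne'

/-- Two countable actions with finite orbits in which all finite index subgroups are stabilizers
of infinitely many points are isomorphic. -/
theorem exists_equivariant_equiv {X Y : Type*} [MulAction H X] [MulAction H Y] [Countable X]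
    [Countable Y] (hX : ∀ x : X, (MulAction.orbit H x).Finite)
    (hY : ∀ y : Y, (MulAction.orbit H y).Finite)
    (hX' : ∀ K : Subgroup H, K.FiniteIndex → {x : X | MulAction.stabilizer H x = K}.Infinite)
    (hY' : ∀ K : Subgroup H, K.FiniteIndex → {y : Y | MulAction.stabilizer H y = K}.Infinite) :
    ∃ e : X ≃ Y, ∀ (h : H) (x : X), e (h • x) = h • e x := by
  -- For a conjugacy class of finite index subgroups both sides have countably infinitely many
  -- orbits of that type; for any other `t` they have none.
  have hfib : ∀ t : Set (Subgroup H),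
      Nonempty ({ω : MulAction.orbitRel.Quotient H X // orbitType H ω = t} ≃
        {ω : MulAction.orbitRel.Quotient H Y // orbitType H ω = t}) := by
    intro t
    have hcX : Countable (MulAction.orbitRel.Quotient H X) := Quotient.countable
    have hcY : Countable (MulAction.orbitRel.Quotient H Y) := Quotient.countable
    by_cases ht : ∃ K : Subgroup H, K.FiniteIndex ∧
        t = Set.range fun h : H => K.map (MulAut.conj h).toMonoidHom
    · obtain ⟨K, hK, rfl⟩ := ht
      have := (infinite_setOf_orbitType_eq H hX (hX' K hK)).to_subtype
      have := (infinite_setOf_orbitType_eq H hY (hY' K hK)).to_subtype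
      exact nonempty_equiv_of_countable
        (α := {ω : MulAction.orbitRel.Quotient H X | _}) (β := {ω : MulAction.orbitRel.Quotient H Y | _})
    · have h1 : IsEmpty {ω : MulAction.orbitRel.Quotient H X // orbitType H ω = t} := by
        refine ⟨fun ⟨ω, hω⟩ => ht ?_⟩
        induction ω using Quotient.inductionOn with
        | _ x => exact ⟨_, finiteIndex_stabilizer H (hX x), hω ▸ orbitType_mk H x⟩
      have h2 : IsEmpty {ω : MulAction.orbitRel.Quotient H Y // orbitType H ω = t} := by
        refine ⟨fun ⟨ω, hω⟩ => ht ?_⟩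
        induction ω using Quotient.inductionOn with
        | _ x => exact ⟨_, finiteIndex_stabilizer H (hY x), hω ▸ orbitType_mk H x⟩
      exact ⟨Equiv.equivOfIsEmpty _ _⟩
  obtain ⟨θ, hθ⟩ : ∃ θ : MulAction.orbitRel.Quotient H X ≃ MulAction.orbitRel.Quotient H Y,
      ∀ ω, orbitType H (θ ω) = orbitType H ω := by
    refine ⟨(Equiv.sigmaFiberEquiv (orbitType H)).symm.trans
      ((Equiv.sigmaCongrRight fun t => (hfib t).some).trans (Equiv.sigmaFiberEquiv (orbitType H))),
      fun ω => ?_⟩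
    exact ((hfib (orbitType H ω)).some ⟨ω, rfl⟩).2
  -- Matching the stabilizer itself, not just its class, makes `h • ω.out ↦ h • y ω` well defined
  -- and injective on the orbit.
  have hy : ∀ ω : MulAction.orbitRel.Quotient H X, ∃ y : Y,
      Quotient.mk _ y = θ ω ∧ MulAction.stabilizer H y = MulAction.stabilizer H ω.out := by
    intro ω
    have : MulAction.stabilizer H ω.out ∈ orbitType H (θ ω) := by
      rw [hθ]
      exact ⟨ω.out, Quotient.out_eq ω, rfl⟩
    exact this
  choose y hyθ hystab using hy
  have hc : ∀ x : X, ∃ h : H, h • (Quotient.mk (MulAction.orbitRel H X) x).out = x := fun x =>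
    MulAction.orbitRel_apply.1
      ((MulAction.orbitRel H X).iseqv.symm (Quotient.mk_out (s := MulAction.orbitRel H X) x))
  choose c hc using hc
  have hstab : ∀ (ω : MulAction.orbitRel.Quotient H X) (h h' : H),
      h • ω.out = h' • ω.out ↔ h • y ω = h' • y ω := by
    intro ω h h'
    rw [← inv_smul_eq_iff, ← inv_smul_eq_iff, smul_smul, smul_smul]
    change _ ∈ MulAction.stabilizer H ω.out ↔ _ ∈ MulAction.stabilizer H (y ω)
    rw [hystab]
  set e : X → Y := fun x => c x • y (Quotient.mk _ x)
  have he : ∀ (ω : MulAction.orbitRel.Quotient H X) (h : H), e (h • ω.out) = h • y ω := by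
    intro ω h
    have hω : (Quotient.mk _ (h • ω.out) : MulAction.orbitRel.Quotient H X) = ω :=
      (Quotient.sound (MulAction.orbitRel_apply.2 ⟨h, rfl⟩)).trans (Quotient.out_eq ω)
    have h1 := hc (h • ω.out)
    change c (h • ω.out) • y _ = _
    rw [hω] at h1 ⊢
    exact (hstab ω _ _).1 h1
  have hex : ∀ x : X, ∃ (ω : MulAction.orbitRel.Quotient H X) (h : H), x = h • ω.out :=
    fun x => ⟨_, _, (hc x).symm⟩
  have hmk : ∀ (ω : MulAction.orbitRel.Quotient H X) (h : H),
      (Quotient.mk _ (h • y ω) : MulAction.orbitRel.Quotient H Y) = θ ω := fun ω h =>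
    (Quotient.sound (MulAction.orbitRel_apply.2 ⟨h, rfl⟩)).trans (hyθ ω)
  refine ⟨Equiv.ofBijective e ⟨fun x x' hxx => ?_, fun z => ?_⟩, fun h x => ?_⟩
  · obtain ⟨ω, h, rfl⟩ := hex x
    obtain ⟨ω', h', rfl⟩ := hex x'
    rw [he, he] at hxx
    obtain rfl : ω = ω' := θ.injective (by rw [← hmk ω h, ← hmk ω' h', hxx])
    exact (hstab ω _ _).2 hxx
  · obtain ⟨ω, hω⟩ := θ.surjective (Quotient.mk _ z)
    obtain ⟨h, hh⟩ : z ∈ MulAction.orbit H (y ω) :=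
      MulAction.orbitRel_apply.1 (Quotient.exact (hω.symm.trans (hyθ ω).symm))
    exact ⟨h • ω.out, (he ω h).trans hh⟩
  · obtain ⟨ω, k, rfl⟩ := hex x
    change e _ = h • e _
    rw [smul_smul, he, he, smul_smul]

end Equivariant

/-! ### Generic tuples and their conjugacy -/

/-- The stabilizer of a point in an action by permutations. -/
def permStabilizer {H X : Type*} [Group H] (ρ : H →* Equiv.Perm X) (x : X) : Subgroup H :=
  (MulAction.stabilizer (Equiv.Perm X) x).comap ρ

theorem mem_permStabilizer {H X : Type*} [Group H] {ρ : H →* Equiv.Perm X} {x : X} {h : H} :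
    h ∈ permStabilizer ρ x ↔ ρ h x = x :=
  Iff.rfl

theorem finite_range_of_finiteIndex_permStabilizer {H X : Type*} [Group H] {ρ : H →* Equiv.Perm X}
    {x : X} (hx : (permStabilizer ρ x).FiniteIndex) : (Set.range fun h => ρ h x).Finite := by
  let := MulAction.compHom X ρ
  have h : MulAction.stabilizer H x = permStabilizer ρ x := rfl
  have h1 := hx.index_ne_zero
  rw [← h, MulAction.index_stabilizer] at h1
  exact Set.finite_of_ncard_ne_zero h1

theorem exists_conj_of_permStabilizer {H X : Type*} [Group H] [Countable X]
    (ρ σ : H →* Equiv.Perm X) (hρ : ∀ x, (Set.range fun h => ρ h x).Finite)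
    (hσ : ∀ x, (Set.range fun h => σ h x).Finite)
    (hρ' : ∀ K : Subgroup H, K.FiniteIndex → {x | permStabilizer ρ x = K}.Infinite)
    (hσ' : ∀ K : Subgroup H, K.FiniteIndex → {x | permStabilizer σ x = K}.Infinite) :
    ∃ e : Equiv.Perm X, ∀ h, σ h = e * ρ h * e⁻¹ := by
  obtain ⟨e, he⟩ := @exists_equivariant_equiv H _ X X (MulAction.compHom X ρ)
    (MulAction.compHom X σ) _ _ hρ hσ hρ' hσ'
  refine ⟨e, fun h => ?_⟩
  rw [eq_mul_inv_iff_mul_eq]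
  ext x
  exact (he h x).symm

/-- The action of the free group given by a tuple of permutations. -/
def freeAction {ι : Type*} (f : ι → Equiv.Perm ℕ) : FreeGroup ι →* Equiv.Perm ℕ :=
  FreeGroup.lift f

theorem freeAction_of {ι : Type*} (f : ι → Equiv.Perm ℕ) (i : ι) :
    freeAction f (FreeGroup.of i) = f i :=
  FreeGroup.lift_apply_of

/-- The restriction of the action to a set that contains all supports. -/
theorem exists_ofSubtype_comp_eq_freeAction {ι : Type*} (f : ι → Equiv.Perm ℕ) {J : Set ℕ}
    [DecidablePred (· ∈ J)] (hJ : ∀ i n, f i n ≠ n → n ∈ J) :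
    ∃ ρ : FreeGroup ι →* Equiv.Perm J, ∀ h, Equiv.Perm.ofSubtype (ρ h) = freeAction f h := by
  have hJ' : ∀ i n, f i n ∈ J ↔ n ∈ J := by
    intro i n
    by_cases hn : f i n = n
    · rw [hn]
    · exact ⟨fun _ => hJ i n hn, fun _ => hJ i _ fun hc => hn ((f i).injective hc)⟩
  refine ⟨FreeGroup.lift fun i => (f i).subtypePerm (hJ' i), fun h => ?_⟩
  refine DFunLike.congr_fun (f := Equiv.Perm.ofSubtype.comp _) (g := freeAction f)
    (FreeGroup.ext_hom _ _ fun i => ?_) h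
  simp only [MonoidHom.comp_apply, FreeGroup.lift_apply_of, freeAction_of]
  exact Equiv.Perm.ofSubtype_subtypePerm (hJ' i) (hJ i)

/-- All orbits are finite and all finite index subgroups are stabilizers of arbitrarily large
points. -/
def IsGenericTuple {ι : Type*} (f : ι → Equiv.Perm ℕ) : Prop :=
  (∀ x, (Set.range fun h => freeAction f h x).Finite) ∧
    ∀ K : Subgroup (FreeGroup ι), K.FiniteIndex → ∀ N : ℕ, ∃ y ≥ N, permStabilizer (freeAction f) y = K

/-- Points with a proper stabilizer are moved by the action, hence lie in `J`. Points with
stabilizer `⊤` might all lie outside `J`, so `W` supplies them. -/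
theorem IsGenericTuple.restrict {ι : Type*} {f : ι → Equiv.Perm ℕ} (hf : IsGenericTuple f)
    {J W : Set ℕ} [DecidablePred (· ∈ J)] (hJ : ∀ i n, f i n ≠ n → n ∈ J) (hWJ : W ⊆ J)
    (hW : W.Infinite) (hfW : ∀ i, ∀ n ∈ W, f i n = n) {ρ : FreeGroup ι →* Equiv.Perm J}
    (hρ : ∀ h, Equiv.Perm.ofSubtype (ρ h) = freeAction f h) :
    (∀ x, (Set.range fun h => ρ h x).Finite) ∧
      ∀ K : Subgroup (FreeGroup ι), K.FiniteIndex → {x | permStabilizer ρ x = K}.Infinite := by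
  have hval : ∀ h (x : J), ((ρ h x : J) : ℕ) = freeAction f h x := fun h x => by
    rw [← hρ, Equiv.Perm.ofSubtype_apply_coe]
  have hstab : ∀ x : J, permStabilizer ρ x = permStabilizer (freeAction f) x := fun x => by
    ext h
    rw [mem_permStabilizer, mem_permStabilizer, ← hval, Subtype.ext_iff]
  have hfix : ∀ n, (∀ i, f i n = n) → permStabilizer (freeAction f) n = ⊤ := by
    intro n hn
    rw [eq_top_iff, ← FreeGroup.closure_range_of, Subgroup.closure_le]
    rintro _ ⟨i, rfl⟩
    change freeAction f (FreeGroup.of i) n = n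
    rw [freeAction_of, hn]
  refine ⟨fun x => ?_, fun K hK => ?_⟩
  · refine Set.Finite.of_finite_image ((hf.1 x).subset ?_) Subtype.val_injective.injOn
    rintro _ ⟨_, ⟨h, rfl⟩, rfl⟩
    exact ⟨h, (hval h x).symm⟩
  · have hval_inf : {n | n ∈ J ∧ permStabilizer (freeAction f) n = K}.Infinite := by
      by_cases hKtop : K = ⊤
      · subst hKtop
        exact hW.mono fun n hn => ⟨hWJ hn, hfix n fun i => hfW i n hn⟩
      · refine Set.infinite_of_not_bddAbove fun ⟨m, hm⟩ => ?_
        obtain ⟨y, hy, hyK⟩ := hf.2 K hK (m + 1)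
        have hyJ : y ∈ J := by
          by_contra hyJ
          refine hKtop (hyK ▸ hfix y fun i => ?_)
          by_contra hc
          exact hyJ (hJ i y hc)
        have := hm ⟨hyJ, hyK⟩
        omega
    intro hfin
    refine hval_inf ((hfin.image Subtype.val).subset ?_)
    rintro n ⟨hn, hnK⟩
    exact ⟨⟨n, hn⟩, (hstab _).trans hnK, rfl⟩

/-- The two actions are matched on `J` only, which confines the conjugator's support to `J`. -/
theorem IsGenericTuple.exists_conj {ι : Type*} {f g : ι → Equiv.Perm ℕ} (hf : IsGenericTuple f)
    (hg : IsGenericTuple g) {J W : Set ℕ} (hfJ : ∀ i n, f i n ≠ n → n ∈ J)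
    (hgJ : ∀ i n, g i n ≠ n → n ∈ J) (hWJ : W ⊆ J) (hW : W.Infinite)
    (hfW : ∀ i, ∀ n ∈ W, f i n = n) (hgW : ∀ i, ∀ n ∈ W, g i n = n) :
    ∃ k : Equiv.Perm ℕ, {n | k n ≠ n} ⊆ J ∧ ∀ i, g i = k * f i * k⁻¹ := by
  classical
  obtain ⟨ρ, hρ⟩ := exists_ofSubtype_comp_eq_freeAction f hfJ
  obtain ⟨σ, hσ⟩ := exists_ofSubtype_comp_eq_freeAction g hgJ
  obtain ⟨hρ1, hρ2⟩ := hf.restrict hfJ hWJ hW hfW hρ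
  obtain ⟨hσ1, hσ2⟩ := hg.restrict hgJ hWJ hW hgW hσ
  obtain ⟨e, he⟩ := exists_conj_of_permStabilizer ρ σ hρ1 hσ1 hρ2 hσ2
  refine ⟨Equiv.Perm.ofSubtype e, fun n hn => ?_, fun i => ?_⟩
  · by_contra hnJ
    exact hn (Equiv.Perm.ofSubtype_apply_of_not_mem e hnJ)
  · rw [← freeAction_of g, ← freeAction_of f, ← hσ, ← hρ, he, map_mul, map_mul, map_inv]

/-- Tuples that agree on an orbit of one of them act in the same way on this orbit. -/
theorem freeAction_apply_eq_of_eqOn {ι : Type*} {f g : ι → Equiv.Perm ℕ} {y : ℕ}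
    (hfg : ∀ i, ∀ z ∈ Set.range (fun h => freeAction f h y), g i z = f i z) (h : FreeGroup ι) :
    freeAction g h y = freeAction f h y := by
  suffices ∀ z ∈ Set.range (fun h => freeAction f h y), freeAction g h z = freeAction f h z from
    this y ⟨1, by simp⟩
  have hinv : ∀ k, ∀ z ∈ Set.range (fun h => freeAction f h y),
      freeAction f k z ∈ Set.range (fun h => freeAction f h y) := by
    rintro k _ ⟨h, rfl⟩
    exact ⟨k * h, by simp⟩
  induction h using FreeGroup.induction_on with
  | C1 => simp
  | of i => simpa [freeAction_of] using hfg i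
  | inv_of i ih =>
    intro z hz
    have := ih _ (hinv (FreeGroup.of i)⁻¹ z hz)
    rw [map_inv, map_inv] at *
    rw [Equiv.Perm.inv_eq_iff_eq, this]
    simp
  | mul a b iha ihb =>
    intro z hz
    rw [map_mul, map_mul, Equiv.Perm.mul_apply, Equiv.Perm.mul_apply, ihb z hz, iha _ (hinv b z hz)]

/-- Finite index subgroups of a finitely generated group are finitely generated, and a countable
group has only countably many finite subsets. -/
theorem countable_finiteIndex_subgroup (H : Type*) [Group H] [Group.FG H] [Countable H] :
    Countable {K : Subgroup H // K.FiniteIndex} := by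
  have : ∀ K : {K : Subgroup H // K.FiniteIndex}, ∃ S : Finset H,
      Subgroup.closure (S : Set H) = K.1 := fun ⟨K, hK⟩ =>
    (Group.fg_iff_subgroup_fg K).1 K.fg_of_index_ne_zero
  choose S hS using this
  refine Function.Injective.countable (f := S) fun K L hKL => Subtype.ext ?_
  rw [← hS K, ← hS L, hKL]

/-- A permutation agrees on a given finite set with a finitely supported permutation, which can be
taken to be trivial at all other fixed points. -/
theorem exists_perm_finite_support (g : Equiv.Perm ℕ) {F : Set ℕ} (hF : F.Finite) :
    ∃ p : Equiv.Perm ℕ, {n | p n ≠ n}.Finite ∧ {n | p n ≠ n} ⊆ {n | g n ≠ n} ∧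
      {n | p n ≠ g n} ⊆ {n | g n ≠ n} \ F := by
  classical
  have hSfin : (F ∩ {n | g n ≠ n}).Finite := hF.inter_of_left _
  set S : Finset ℕ := hSfin.toFinset
  have hS : ∀ n, n ∈ S ↔ n ∈ F ∧ g n ≠ n := fun n => by simp [S]
  -- The injection `g : S → T` extends to a permutation of the finite set `T`, and `g` moves every
  -- point of `T`.
  set T : Finset ℕ := S ∪ S.image g
  have hT : ∀ n ∈ T, g n ≠ n := by
    intro n hn
    rcases Finset.mem_union.1 hn with hn | hn
    · exact ((hS n).1 hn).2
    · obtain ⟨k, hk, rfl⟩ := Finset.mem_image.1 hn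
      exact fun hc => ((hS k).1 hk).2 (g.injective hc)
  obtain ⟨e, he⟩ := Finset.exists_equiv_extend_of_card_eq (α := T) (t := T) (by simp)
    (s := Finset.univ.filter fun x : T => x.1 ∈ S) (f := fun x => g x.1)
    (by
      intro n hn
      obtain ⟨x, hx, rfl⟩ := Finset.mem_image.1 hn
      exact Finset.mem_union_right _ (Finset.mem_image_of_mem _ (Finset.mem_filter.1 hx).2))
    (fun x _ x' _ h => Subtype.ext (g.injective h))
  have hout : ∀ n, n ∉ T → Equiv.Perm.ofSubtype (p := (· ∈ T)) e n = n := fun n hn =>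
    Equiv.Perm.ofSubtype_apply_of_not_mem e hn
  refine ⟨Equiv.Perm.ofSubtype (p := (· ∈ T)) e, T.finite_toSet.subset fun n hn => ?_,
    fun n hn => ?_, fun n hn => ?_⟩
  · by_contra hc
    exact hn (hout n hc)
  · by_contra hc
    exact hn (hout n fun hnT => hc (hT n hnT))
  · have hgn : g n ≠ n := by
      by_cases hnT : n ∈ T
      · exact hT n hnT
      · rw [Set.mem_ofPred_eq, hout n hnT] at hn
        exact hn.symm
    refine ⟨hgn, fun hnF => hn ?_⟩
    have hnS : n ∈ S := (hS n).2 ⟨hnF, hgn⟩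
    have hnT : n ∈ T := Finset.mem_union_left _ hnS
    rw [Equiv.Perm.ofSubtype_apply_of_mem e hnT]
    exact he ⟨n, hnT⟩ (by simpa using hnS)

theorem finite_range_freeAction_of_finite_support {ι : Type*} [Finite ι] {f : ι → Equiv.Perm ℕ}
    (hf : ∀ i, {n | f i n ≠ n}.Finite) (x : ℕ) : (Set.range fun h => freeAction f h x).Finite := by
  classical
  set J : Set ℕ := ⋃ i, {n | f i n ≠ n}
  obtain ⟨ρ, hρ⟩ := exists_ofSubtype_comp_eq_freeAction f (J := J)
    fun i n hn => Set.mem_iUnion.2 ⟨i, hn⟩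
  refine ((Set.finite_iUnion hf).insert x).subset ?_
  rintro _ ⟨h, rfl⟩
  dsimp only
  rw [← hρ]
  by_cases hx : x ∈ J
  · rw [Equiv.Perm.ofSubtype_apply_of_mem _ hx]
    exact Or.inr (ρ h ⟨x, hx⟩).2
  · rw [Equiv.Perm.ofSubtype_apply_of_not_mem _ hx]
    exact Or.inl rfl

/-- A copy of the coset action can be added to a tuple at common fixed points. -/
theorem permStabilizer_freeAction_mul_viaEmbedding {ι : Type*} (f : ι → Equiv.Perm ℕ)
    (K : Subgroup (FreeGroup ι)) (e : FreeGroup ι ⧸ K ↪ ℕ) (hfe : ∀ i c, f i (e c) = e c) :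
    permStabilizer (freeAction fun i =>
      f i * (MulAction.toPerm (FreeGroup.of i) : Equiv.Perm (FreeGroup ι ⧸ K)).viaEmbedding e)
      (e ((1 : FreeGroup ι) : FreeGroup ι ⧸ K)) = K := by
  set F : ι → Equiv.Perm ℕ := fun i =>
    f i * (MulAction.toPerm (FreeGroup.of i) : Equiv.Perm (FreeGroup ι ⧸ K)).viaEmbedding e
  have hact : ∀ (h : FreeGroup ι) (c : FreeGroup ι ⧸ K), freeAction F h (e c) = e (h • c) := by
    intro h
    induction h using FreeGroup.induction_on with
    | C1 => simp
    | of i =>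
      intro c
      rw [freeAction_of, Equiv.Perm.mul_apply, Equiv.Perm.viaEmbedding_apply, hfe]
      rfl
    | inv_of i ih =>
      intro c
      have := ih ((FreeGroup.of i)⁻¹ • c)
      rw [smul_inv_smul] at this
      rw [map_inv, Equiv.Perm.inv_eq_iff_eq, this]
    | mul a b iha ihb =>
      intro c
      rw [map_mul, Equiv.Perm.mul_apply, ihb, iha, mul_smul]
  ext h
  rw [mem_permStabilizer, hact, e.apply_eq_iff_eq, ← MulAction.mem_stabilizer_iff,
    MulAction.stabilizer_quotient]

/-! ### Ample generics -/

theorem Order.Ideal.iUnion_mem {α ι : Type*} [Finite ι] (I : Order.Ideal (Set α)) {A : ι → Set α}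
    (hA : ∀ i, A i ∈ I) : (⋃ i, A i) ∈ I := by
  classical
  have := Fintype.ofFinite ι
  have : ∀ s : Finset ι, (⋃ i ∈ s, A i) ∈ I := by
    intro s
    induction s using Finset.induction_on with
    | empty => simpa using I.bot_mem
    | insert a s _ ih =>
      rw [Finset.set_biUnion_insert]
      exact Order.Ideal.sup_mem (hA a) ih
  simpa using this Finset.univ

namespace LSCSubmeasure.Represents

variable {φ : LSCSubmeasure} {I : Order.Ideal (Set ℕ)}

theorem eventually_eqOn (h : φ.Represents I) {ι : Type*} [Finite ι] (f : ι → permGroup I)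
    {O : Set ℕ} (hO : O.Finite) :
    ∀ᶠ g in @nhds _ (@Pi.topologicalSpace ι _
      fun _ => (φ.permMetric I).toUniformSpace.toTopologicalSpace) f,
      ∀ i, ∀ z ∈ O, (g i).1 z = (f i).1 z := by
  let M := φ.permMetric I
  refine eventually_all.2 fun i => (hO.eventually_all).2 fun z _ => ?_
  have := ((h.continuous_apply z).comp (_root_.continuous_apply i)).tendsto f
  rw [nhds_discrete ℕ, tendsto_pure] at this
  exact this

theorem dense_of_forall_exists {ι : Type*} {S : Set (ι → permGroup I)}
    (hS : ∀ (f : ι → permGroup I) (ε : ℝ≥0∞), 0 < ε →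
      ∃ g ∈ S, ∀ i, φ.toFun {n | (g i).1 n ≠ (f i).1 n} ≤ ε) :
    @Dense _ (@Pi.topologicalSpace ι _
      fun _ => (φ.permMetric I).toUniformSpace.toTopologicalSpace) S := by
  let M := φ.permMetric I
  intro f
  choose g hgS hg using fun k : ℕ => hS f (2⁻¹ ^ k) (ENNReal.pow_pos (by simp) k)
  refine mem_closure_of_tendsto (f := g) (b := atTop) (tendsto_pi_nhds.2 fun i => ?_)
    (Eventually.of_forall hgS)
  refine (tendsto_iff _ _).2 (tendsto_of_tendsto_of_tendsto_of_le_of_le tendsto_const_nhds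
    (ENNReal.tendsto_pow_atTop_nhds_zero_of_lt_one (r := 2⁻¹) (by simp)) (fun _ => zero_le)
    fun k => hg k i)

/-- Open, because a tuple that agrees with `f` on a finite orbit has the same orbit there. Dense,
because finitely supported tuples are dense. -/
theorem setOf_finite_range_mem_residual (h : φ.Represents I) {ι : Type*} [Finite ι] (x : ℕ) :
    {f : ι → permGroup I | (Set.range fun k => freeAction (fun i => (f i).1) k x).Finite} ∈
      @residual _ (@Pi.topologicalSpace ι _
        fun _ => (φ.permMetric I).toUniformSpace.toTopologicalSpace) := by
  let M := φ.permMetric I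
  refine residual_of_dense_open ?_ (dense_of_forall_exists fun f ε hε => ?_)
  · refine isOpen_iff_mem_nhds.2 fun f hf => ?_
    filter_upwards [h.eventually_eqOn f hf] with g hg
    have := freeAction_apply_eq_of_eqOn (f := fun i => (f i).1) (g := fun i => (g i).1) hg
    simp only [this]
    exact hf
  · choose m hm using fun i => h.exists_tail_lt (f i).2 hε
    choose p hp1 hp2 hp3 using fun i =>
      exists_perm_finite_support (f i).1 (Set.finite_Icc 0 (m i))
    refine ⟨fun i => ⟨p i, I.lower (hp2 i) (f i).2⟩, ?_, fun i => ?_⟩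
    · exact finite_range_freeAction_of_finite_support hp1 x
    · exact (φ.mono' _ _ (hp3 i)).trans (hm i).le

/-- Open, because the orbit of `y` is finite and determines its stabilizer. Dense, because the
finite coset action on `FreeGroup ι ⧸ K` can be grafted onto common fixed points far out in a member
of `I`, at little cost. -/
theorem setOf_exists_permStabilizer_eq_mem_residual (h : φ.Represents I)
    (hW : ∀ J ∈ I, ∃ W ∈ I, W.Infinite ∧ Disjoint W J) {ι : Type*} [Finite ι]
    (K : Subgroup (FreeGroup ι)) (hK : K.FiniteIndex) (N : ℕ) :
    {f : ι → permGroup I | ∃ y ≥ N, permStabilizer (freeAction fun i => (f i).1) y = K} ∈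
      @residual _ (@Pi.topologicalSpace ι _
        fun _ => (φ.permMetric I).toUniformSpace.toTopologicalSpace) := by
  let M := φ.permMetric I
  refine residual_of_dense_open ?_ (dense_of_forall_exists fun f ε hε => ?_)
  · refine isOpen_iff_mem_nhds.2 fun f ⟨y, hy, hfy⟩ => ?_
    filter_upwards [h.eventually_eqOn f (finite_range_of_finiteIndex_permStabilizer
      (hfy.symm ▸ hK))] with g hg
    refine ⟨y, hy, ?_⟩
    rw [← hfy]
    ext k
    rw [mem_permStabilizer, mem_permStabilizer,
      freeAction_apply_eq_of_eqOn (f := fun i => (f i).1) (g := fun i => (g i).1) hg]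
  · obtain ⟨W, hWI, hWinf, hWf⟩ := hW _ (I.iUnion_mem fun i => (f i).2)
    obtain ⟨m, hm⟩ := h.exists_tail_lt hWI hε
    have hinf : Infinite ↥(W \ Set.Icc 0 (max m N)) :=
      (hWinf.sdiff (Set.finite_Icc _ _)).to_subtype
    have : Finite (FreeGroup ι ⧸ K) := Subgroup.finite_quotient_of_finiteIndex
    let e : FreeGroup ι ⧸ K ↪ ℕ :=
      (((Finite.equivFin _).toEmbedding.trans Fin.valEmbedding).trans
        (Infinite.natEmbedding ↥(W \ Set.Icc 0 (max m N)))).trans (Function.Embedding.subtype _)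
    have he : ∀ c, e c ∈ W \ Set.Icc 0 (max m N) := fun c => Subtype.property _
    have hsupp : ∀ q : Equiv.Perm (FreeGroup ι ⧸ K),
        {n | q.viaEmbedding e n ≠ n} ⊆ W \ Set.Icc 0 (max m N) := by
      intro q n hn
      by_cases hne : n ∈ Set.range e
      · obtain ⟨c, rfl⟩ := hne
        exact he c
      · exact absurd (Equiv.Perm.viaEmbedding_apply_of_notMem _ _ _ hne) hn
    have hfe : ∀ i c, (f i).1 (e c) = e c := by
      intro i c
      by_contra hc
      exact Set.disjoint_left.1 hWf (he c).1 (Set.mem_iUnion.2 ⟨i, hc⟩)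
    let q : ι → permGroup I := fun i =>
      ⟨(MulAction.toPerm (FreeGroup.of i) : Equiv.Perm (FreeGroup ι ⧸ K)).viaEmbedding e,
        I.lower ((hsupp _).trans Set.sdiff_subset) hWI⟩
    refine ⟨fun i => f i * q i, ⟨_, ?_, permStabilizer_freeAction_mul_viaEmbedding
      (fun i => (f i).1) K e hfe⟩, fun i => (φ.mono' _ _ fun n hn => ?_).trans hm.le⟩
    · by_contra hc
      exact (he _).2 ⟨Nat.zero_le _, (not_le.1 hc).le.trans (le_max_right _ _)⟩
    · have hqn : (q i).1 n ≠ n := fun hc => hn (congrArg (f i).1 hc)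
      have := hsupp _ hqn
      exact ⟨this.1, fun hnm => this.2 ⟨hnm.1, hnm.2.trans (le_max_left _ _)⟩⟩

theorem hasAmpleGenerics (h : φ.Represents I)
    (hW : ∀ J ∈ I, ∃ W ∈ I, W.Infinite ∧ Disjoint W J) :
    @HasAmpleGenerics (permGroup I) _ (φ.permMetric I).toUniformSpace.toTopologicalSpace := by
  let M := φ.permMetric I
  have := h.polishSpace
  intro n
  set T : Set (Fin (n + 1) → permGroup I) := {f | IsGenericTuple fun i => (f i).1}
  have hT : T ∈ residual (Fin (n + 1) → permGroup I) := by
    have := countable_finiteIndex_subgroup (FreeGroup (Fin (n + 1)))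
    have h1 := eventually_countable_forall.2 fun x =>
      h.setOf_finite_range_mem_residual (ι := Fin (n + 1)) x
    have h2 := eventually_countable_forall.2
      fun K : {K : Subgroup (FreeGroup (Fin (n + 1))) // K.FiniteIndex} =>
        eventually_countable_forall.2 fun N =>
          h.setOf_exists_permStabilizer_eq_mem_residual hW (ι := Fin (n + 1)) K.1 K.2 N
    filter_upwards [h1, h2] with f hf1 hf2
    exact ⟨hf1, fun K hK N => hf2 ⟨K, hK⟩ N⟩
  obtain ⟨x, hx⟩ := (dense_of_mem_residual hT).nonempty
  refine ⟨x, mem_of_superset hT fun y hy => ?_⟩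
  set F : Set ℕ := (⋃ i, {n | (x i).1 n ≠ n}) ∪ ⋃ i, {n | (y i).1 n ≠ n}
  have hF : F ∈ I := Order.Ideal.sup_mem (I.iUnion_mem fun i => (x i).2)
    (I.iUnion_mem fun i => (y i).2)
  obtain ⟨W, hWI, hWinf, hWF⟩ := hW F hF
  rw [Set.disjoint_left] at hWF
  -- Since `F ∪ W` belongs to `I`, the conjugator is an element of `S_I`.
  obtain ⟨k, hk, hky⟩ := IsGenericTuple.exists_conj hx hy (J := F ∪ W) (W := W)
    (fun i n hn => Or.inl (Or.inl (Set.mem_iUnion.2 ⟨i, hn⟩)))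
    (fun i n hn => Or.inl (Or.inr (Set.mem_iUnion.2 ⟨i, hn⟩))) Set.subset_union_right hWinf
    (fun i n hn => not_not.1 fun hc => hWF hn (Or.inl (Set.mem_iUnion.2 ⟨i, hc⟩)))
    (fun i n hn => not_not.1 fun hc => hWF hn (Or.inr (Set.mem_iUnion.2 ⟨i, hc⟩)))
  refine ⟨⟨k, I.lower hk (Order.Ideal.sup_mem hF hWI)⟩, funext fun i => Subtype.ext (hky i)⟩

end LSCSubmeasure.Represents

/-! ### The summable ideal -/

/-- The inverse is taken in `NNReal`, where `0⁻¹ = 0`; in `ℝ≥0∞` the point `0` would contribute `∞`.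
-/
theorem mem_summableIdeal_iff_tsum {A : Set ℕ} :
    A ∈ summableIdeal ↔ ∑' n : A, ((((n : ℕ) : NNReal)⁻¹ : NNReal) : ℝ≥0∞) ≠ ∞ := by
  rw [ENNReal.tsum_coe_ne_top_iff_summable, ← NNReal.summable_coe]
  change (Summable fun n : A => 1 / ((n : ℕ) : ℝ)) ↔ _
  simp

theorem isSigmaZeroTwo_summableIdeal : IsSigmaZeroTwo summableIdeal := by
  refine ⟨fun k => {x | ∀ s : Finset ℕ, ∑ n ∈ s, (if x n = true then 1 / (n : ℝ) else 0) ≤ k},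
    fun k => ?_, ?_⟩
  · simp only [Set.ofPred_forall]
    refine isClosed_iInter fun s => isClosed_le (continuous_finsetSum _ fun n _ => ?_)
      continuous_const
    exact (continuous_of_discreteTopology (f := fun b : Bool => if b = true then 1 / (n : ℝ) else 0)).comp
      (continuous_apply n)
  · ext x
    have h1 : x ∈ {x : ℕ → Bool | {n | x n = true} ∈ summableIdeal} ↔
        Summable fun n : ℕ => if x n = true then 1 / (n : ℝ) else 0 := by
      refine (summable_subtype_iff_indicator (f := fun n : ℕ => 1 / (n : ℝ))
        (s := {n | x n = true})).trans ?_
      exact summable_congr fun n => by by_cases hx : x n = true <;> simp [Set.indicator, hx]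
    have h0 : ∀ n : ℕ, (0 : ℝ) ≤ if x n = true then 1 / (n : ℝ) else 0 := fun n => by
      split_ifs <;> positivity
    rw [h1, Set.mem_iUnion]
    refine ⟨fun h => ?_, fun ⟨k, hk⟩ => summable_of_sum_le h0 hk⟩
    obtain ⟨k, hk⟩ := exists_nat_ge (∑' n : ℕ, if x n = true then 1 / (n : ℝ) else 0)
    exact ⟨k, fun s => (h.sum_le_tsum s fun n _ => h0 n).trans hk⟩

theorem iUnion_mem_summableIdeal (A : ℕ → Set ℕ)
    (hA : ∀ k, ∑' n : A k, ((((n : ℕ) : NNReal)⁻¹ : NNReal) : ℝ≥0∞) ≤ 2⁻¹ ^ k) :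
    (⋃ k, A k) ∈ summableIdeal := by
  rw [mem_summableIdeal_iff_tsum]
  refine ne_top_of_le_ne_top ?_ ((ENNReal.tsum_iUnion_le_tsum
    (fun n : ℕ => (((n : NNReal)⁻¹ : NNReal) : ℝ≥0∞)) A).trans (ENNReal.tsum_le_tsum hA))
  rw [ENNReal.tsum_geometric]
  simp

/-- Deleting a finite part of `A k` brings its sum down to `2⁻¹ ^ k`; the remainders unite to a
pseudo-union. -/
theorem isPIdeal_summableIdeal : IsPIdeal summableIdeal := by
  intro A hA
  have hs : ∀ k, ∃ s : Finset ℕ,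
      ∑' n : ↥(A k \ s), ((((n : ℕ) : NNReal)⁻¹ : NNReal) : ℝ≥0∞) ≤ 2⁻¹ ^ k := by
    intro k
    have h := mem_summableIdeal_iff_tsum.1 (hA k)
    rw [tsum_subtype (A k) (fun n : ℕ => (((n : NNReal)⁻¹ : NNReal) : ℝ≥0∞))] at h
    obtain ⟨s, hs⟩ := ((ENNReal.tendsto_tsum_compl_atTop_zero h).eventually
      (gt_mem_nhds (ENNReal.pow_pos (a := 2⁻¹) (by simp) k))).exists
    refine ⟨s, le_trans (le_of_eq ?_) hs.le⟩
    rw [tsum_subtype (A k \ s) (fun n : ℕ => (((n : NNReal)⁻¹ : NNReal) : ℝ≥0∞))]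
    refine Eq.trans ?_ (tsum_subtype {n | n ∉ s} _).symm
    have hset : A k \ s = {n | n ∉ s} ∩ A k := by
      ext n
      simp [and_comm]
    rw [Set.indicator_indicator, hset]
  choose s hs using hs
  refine ⟨_, iUnion_mem_summableIdeal _ hs, fun k => (s k).finite_toSet.subset fun n hn => ?_⟩
  by_contra hc
  exact hn.2 (Set.mem_iUnion.2 ⟨k, hn.1, hc⟩)

theorem containsFin_summableIdeal : ContainsFin summableIdeal := by
  intro A hA
  have := hA.to_subtype
  change Summable fun n : A => 1 / ((n : ℕ) : ℝ)
  exact Summable.of_finite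

/-- A finite `A` would put `ℕ` into the ideal, against divergence of the harmonic series. An
infinite `A` contains an infinite summable set, with elements above `2 ^ k`. -/
theorem not_isTrivialModificationOfFin_summableIdeal :
    ¬ IsTrivialModificationOfFin summableIdeal := by
  rintro ⟨A, hA⟩
  by_cases hfin : A.Finite
  · have huniv : Set.univ ∈ summableIdeal := (hA _).2 (hfin.inter_of_left _)
    have : Summable fun n : (Set.univ : Set ℕ) => 1 / ((n : ℕ) : ℝ) := huniv
    have := (summable_subtype_iff_indicator (f := fun n : ℕ => 1 / (n : ℝ))).1 this
    rw [Set.indicator_univ] at this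
    exact Real.not_summable_one_div_natCast this
  · choose b hbA hb using fun k : ℕ => Set.Infinite.exists_gt hfin (2 ^ k)
    have hmem : (⋃ k, {b k}) ∈ summableIdeal := by
      refine iUnion_mem_summableIdeal _ fun k => ?_
      rw [tsum_singleton (b k) (fun n : ℕ => (((n : NNReal)⁻¹ : NNReal) : ℝ≥0∞)),
        ENNReal.coe_inv (by exact_mod_cast ((Nat.zero_le _).trans_lt (hb k)).ne'), ← ENNReal.inv_pow]
      exact ENNReal.inv_le_inv.2 (by exact_mod_cast (hb k).le)
    have := (hA _).1 hmem
    obtain ⟨m, hm⟩ := this.bddAbove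
    have h1 := hm ⟨hbA m, Set.mem_iUnion.2 ⟨m, rfl⟩⟩
    have h2 := hb m
    have h3 : m < 2 ^ m := Nat.lt_two_pow_self
    omega

theorem exists_isIdealTopology {I : Order.Ideal (Set ℕ)} (hσ : IsSigmaZeroTwo I) (hP : IsPIdeal I)
    (hfin : ContainsFin I) (hI : ¬ IsTrivialModificationOfFin I) :
    ∃ τ : TopologicalSpace (permGroup I),
      IsIdealTopology I τ ∧ IsNonNonArchimedeanPolishAmple (permGroup I) := by
  obtain ⟨φ, h, hsmall⟩ := exists_represents hσ hP hfin
  obtain ⟨A, hA, hφA⟩ := h.exists_notMem_vanishesAlong hsmall hI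
  refine ⟨(φ.permMetric I).toUniformSpace.toTopologicalSpace, h.isIdealTopology, ?_⟩
  let M := φ.permMetric I
  exact
    { isTopologicalGroup := h.isTopologicalGroup
      polishSpace := h.polishSpace
      hasAmpleGenerics := h.hasAmpleGenerics fun _ hJ => h.exists_infinite_mem_disjoint hA hφA hJ
      not_isZeroDimensional := h.not_isZeroDimensional hsmall hI
      not_isNonArchimedean := h.not_isNonArchimedean hsmall hI
      not_nonarchimedeanGroup := h.not_nonarchimedeanGroup hsmall hI }

theorem mainTheorem2 :
    (∀ I : Order.Ideal (Set ℕ), IsSigmaZeroTwo I → IsPIdeal I → ContainsFin I →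
      ¬ IsTrivialModificationOfFin I →
      ∃ τ : TopologicalSpace (permGroup I),
        IsIdealTopology I τ ∧ IsNonNonArchimedeanPolishAmple (permGroup I)) ∧
    (IsSigmaZeroTwo summableIdeal ∧ IsPIdeal summableIdeal ∧ ContainsFin summableIdeal ∧
      ¬ IsTrivialModificationOfFin summableIdeal) ∧
    (∃ τ : TopologicalSpace (permGroup summableIdeal),
      IsIdealTopology summableIdeal τ ∧
        IsNonNonArchimedeanPolishAmple (permGroup summableIdeal)) ∧
    (∃ (G : Type) (_ : Group G) (_ : TopologicalSpace G), IsNonNonArchimedeanPolishAmple G) := by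
  have hsum := exists_isIdealTopology isSigmaZeroTwo_summableIdeal isPIdeal_summableIdeal
    containsFin_summableIdeal not_isTrivialModificationOfFin_summableIdeal
  refine ⟨fun _ hσ hP hfin hI => exists_isIdealTopology hσ hP hfin hI,
    ⟨isSigmaZeroTwo_summableIdeal, isPIdeal_summableIdeal, containsFin_summableIdeal,
      not_isTrivialModificationOfFin_summableIdeal⟩, hsum, ?_⟩
  obtain ⟨τ, _, hτ⟩ := hsum
  exact ⟨permGroup summableIdeal, inferInstance, τ, hτ⟩
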